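/- **Theorem 6.1.** Let $S=\mathbb{C}[x,y,z]$ and let $\omega\in\mathbb{C}$ satisfy $\omega^2+\omega+1=0$. For $\lambda\in\mathbb{C}$ put $f(\lambda)=f_1(\lambda)\cdots f_{12}(\lambda)$, where $f_1=x^2+(\lambda+1)(\omega xy+\omega^2xz+yz)+\omega^2y^2+\omega z^2$, $f_2=x^2+(\lambda+1)(\omega^2xy+\omega xz+yz)+\omega y^2+\omega^2z^2$, $f_3=xy-\lambda z^2$, $f_4=x^2+(\omega\lambda+1)(xy+\omega xz+\omega yz)+y^2+\omega^2z^2$, $f_5=x^2+(\omega^2\lambda+1)(xy+\omega^2xz+\omega^2yz)+y^2+\omega z^2$, $f_6=x^2+(\omega\lambda+\omega^2)(xy+yz+\omega xz)+\omega y^2+z^2$, $f_7=xz-\lambda y^2$, $f_8=x^2+(\omega^2\lambda+\omega)(xy+yz+\omega^2xz)+\omega^2y^2+z^2$, $f_9=x^2+(\lambda+\omega^2)(xy+xz+\omega^2yz)+\omega y^2+\omega z^2$, $f_{10}=x^2+(\lambda+\omega)(xy+xz+\omega yz)+\omega^2(y^2+z^2)$, $f_{11}=\lambda x^2-yz$,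 $f_{12}=x^2+(\lambda+1)(xy+xz+yz)+y^2+z^2$. A reduced curve $C: f=0$ of degree $d$ in $\mathbb{P}^2_{\mathbb{C}}$ is called free with exponents $(d_1,d_2)$, $1\le d_1\le d_2$, if $d_1+d_2=d-1$ and the Milnor algebra $M(f)=S/(f_x,f_y,f_z)$ has a minimal graded free resolution $$0\to S(1-d-d_1)\oplus S(1-d-d_2)\to S(1-d)^3\xrightarrow{(f_x,f_y,f_z)} S\to M(f)\to 0.$$ Let $\mathcal{B}(\lambda)$ be the union of those conics $f_j(\lambda)=0$, $1\le j\le 12$, that are smooth. (1) For every $\lambda\in\{-2,-2\omega,-2\omega^2,0,1,\omega,\omega^2\}$, exactly nine of the twelve conics $f_j(\lambda)=0$ are smooth, these nine are pairwise distinct, and the product of the other three $f_j(\lambda)$ is, up to a nonzero constant, $(\ell_1\ell_2\ell_3)^2$, where $\ell_1,\ell_2,\ell_3$ are linear forms that define three distinct lines. The conic-line arrangement $\mathcal{A}(\lambda)$, the union of the nine smooth conics with the three lines $\ell_1\ell_2\ell_3=0$ (each taken with multiplicity one), is free with exponents $(7,13)$. (2) For every $\lambda\in\{1,\omega,\omega^2\}$,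 the conic arrangement $\mathcal{B}(\lambda)$ is free with exponents $(7,10)$. -/

import Mathlib

open MvPolynomial

noncomputable section

namespace HesseConics

/-- The graded polynomial ring `ℂ[x, y, z]`. -/
abbrev S : Type := MvPolynomial (Fin 3) ℂ

/-! ### Free plane curves -/

/-- The Jacobian ideal, spanned by the three partial derivatives of `f`. -/
def jacobianIdeal (f : S) : Ideal S :=
  Ideal.span (Set.range fun i : Fin 3 => pderiv i f)

/-- The Milnor algebra `M(f) = S / J_f`. -/
abbrev MilnorAlgebra (f : S) : Type := S ⧸ jacobianIdeal f

/-- The map `S³ → S`, `(a, b, c) ↦ a f_x + b f_y + c f_z`. -/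
def gradientMap (f : S) : (Fin 3 → S) →ₗ[S] S :=
  Fintype.linearCombination S (fun i : Fin 3 => pderiv i f)

/-- The map `S² → S³`, `(u, v) ↦ u r₀ + v r₁`. -/
def relationMap (r : Fin 2 → Fin 3 → S) : (Fin 2 → S) →ₗ[S] (Fin 3 → S) :=
  Fintype.linearCombination S r

/-- The plane curve `f = 0` of degree `d` is `2`-syzygy, with degrees `d₁ ≤ d₂`: its Milnor
algebra has a minimal graded free resolution
`0 → S(1-d-d₁) ⊕ S(1-d-d₂) → S(1-d)³ → S → M(f) → 0`.
The middle map is given by the partial derivatives (which are homogeneous of degree `d - 1`), and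
the first one by two triples of homogeneous polynomials of degrees `d₁`, `d₂`. Minimality means
that all the entries of the matrices of these maps lie in the maximal ideal `(x, y, z)`. -/
structure IsTwoSyzygy (f : S) (d d₁ d₂ : ℕ) : Prop where
  homogeneous : f.IsHomogeneous d
  one_le : 1 ≤ d₁
  le : d₁ ≤ d₂
  resolution : ∃ r : Fin 2 → Fin 3 → S,
    (∀ k, (r 0 k).IsHomogeneous d₁) ∧ (∀ k, (r 1 k).IsHomogeneous d₂) ∧
    Function.Injective (relationMap r) ∧
    Function.Exact (relationMap r) (gradientMap f) ∧
    Function.Exact (gradientMap f) (Ideal.Quotient.mk (jacobianIdeal f) : S → MilnorAlgebra f) ∧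
    Function.Surjective (Ideal.Quotient.mk (jacobianIdeal f) : S → MilnorAlgebra f) ∧
    (∀ i k, constantCoeff (r i k) = 0) ∧ (∀ k, constantCoeff (pderiv k f) = 0)

/-- The curve `f = 0` is a reduced plane curve, and it is free with exponents `(d₁, d₂)`. -/
def IsFreeCurve (f : S) (d₁ d₂ : ℕ) : Prop :=
  Squarefree f ∧ ∃ d : ℕ, IsTwoSyzygy f d d₁ d₂ ∧ d₁ + d₂ + 1 = d

/-! ### The Hesse family of conics and its degenerations -/

/-- The coefficients `a x² + b xy + c xz + e yz + g y² + h z²` of a conic. -/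
def quadric (a b c e g h : ℂ) : S :=
  C a * X 0 ^ 2 + C b * (X 0 * X 1) + C c * (X 0 * X 2) + C e * (X 1 * X 2)
    + C g * X 1 ^ 2 + C h * X 2 ^ 2

/-- The equations `f₁(t), …, f₁₂(t)` of the twelve conics with parameter `t`
(index `j : Fin 12` is the conic number `j + 1`); `ω` is a primitive cube root of unity. -/
def conic (ω t : ℂ) : Fin 12 → S :=
  ![quadric 1 ((t + 1) * ω) ((t + 1) * ω ^ 2) (t + 1) (ω ^ 2) ω,
    quadric 1 ((t + 1) * ω ^ 2) ((t + 1) * ω) (t + 1) ω (ω ^ 2),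
    quadric 0 1 0 0 0 (-t),
    quadric 1 (ω * t + 1) ((ω * t + 1) * ω) ((ω * t + 1) * ω) 1 (ω ^ 2),
    quadric 1 (ω ^ 2 * t + 1) ((ω ^ 2 * t + 1) * ω ^ 2) ((ω ^ 2 * t + 1) * ω ^ 2) 1 ω,
    quadric 1 (ω * t + ω ^ 2) ((ω * t + ω ^ 2) * ω) (ω * t + ω ^ 2) ω 1,
    quadric 0 0 1 0 (-t) 0,
    quadric 1 (ω ^ 2 * t + ω) ((ω ^ 2 * t + ω) * ω ^ 2) (ω ^ 2 * t + ω) (ω ^ 2) 1,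
    quadric 1 (t + ω ^ 2) (t + ω ^ 2) ((t + ω ^ 2) * ω ^ 2) ω ω,
    quadric 1 (t + ω) (t + ω) ((t + ω) * ω) (ω ^ 2) (ω ^ 2),
    quadric t 0 0 (-1) 0 0,
    quadric 1 (t + 1) (t + 1) (t + 1) 1 1]

/-- The product `f(t) = f₁(t) ⋯ f₁₂(t)`, which defines the multiarrangement `𝒞(t)`. -/
def hesseProduct (ω t : ℂ) : S := ∏ j, conic ω t j

/-- The projective plane curve `g = 0` has no singular point. -/
def IsSmoothCurve (g : S) : Prop :=
  ∀ v : Fin 3 → ℂ, v ≠ 0 → eval v g = 0 → ∃ i, eval v (pderiv i g) ≠ 0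

open Classical in
/-- The indices of the smooth conics among the twelve. -/
def smoothIndices (ω t : ℂ) : Finset (Fin 12) :=
  Finset.univ.filter fun j => IsSmoothCurve (conic ω t j)

/-- The equation of the conic arrangement `ℬ(t)`, the union of the smooth conics in `𝒞(t)`. -/
def arrB (ω t : ℂ) : S := ∏ j ∈ smoothIndices ω t, conic ω t j

/-- The multiarrangement `𝒞(t)` consists of 9 distinct smooth conics (the members of `ℬ(t)`), each
of multiplicity one, and of the three distinct lines `ℓ 0, ℓ 1, ℓ 2`, each of multiplicity two. -/
structure IsNineConicsThreeDoubleLines (ω t : ℂ) (ℓ : Fin 3 → S) : Prop where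
  card_conics : (smoothIndices ω t).card = 9
  conics_distinct : ∀ i ∈ smoothIndices ω t, ∀ j ∈ smoothIndices ω t, i ≠ j →
    ¬ Associated (conic ω t i) (conic ω t j)
  line_homogeneous : ∀ i, (ℓ i).IsHomogeneous 1
  line_ne_zero : ∀ i, ℓ i ≠ 0
  lines_distinct : ∀ i j, i ≠ j → ¬ Associated (ℓ i) (ℓ j)
  factorization : ∃ c : ℂ, c ≠ 0 ∧ hesseProduct ω t = C c * arrB ω t * ∏ i, ℓ i ^ 2

/-- The equation of the conic-line arrangement `𝒜(t)`, obtained from `𝒞(t)` by replacing its double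
lines `ℓ 0, ℓ 1, ℓ 2` by the corresponding reduced lines. -/
def arrA (ω t : ℂ) (ℓ : Fin 3 → S) : S := arrB ω t * ∏ i, ℓ i

end HesseConics

end

noncomputable section

namespace HesseConics

/-! ### Vectors of length three over a domain -/

/-! Up to linear changes of coordinates only two configurations occur. The conic `e (x² + y² + z²) +
xy + xz + yz` and its images under `y ↦ ωⁱ y`, `z ↦ ωʲ z` are the nine smooth conics, with the
coordinate triangle as the three lines: `e = 1` for `t = 0, -2, -2ω, -2ω²`, and `e = 0` for `t = 1,
ω, ω²` (`HasNormalForm`). At `t = 0` the family is already in this form; at `t = 1` and `t = -2` the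
discrete Fourier transform brings it there; `z ↦ ωz` permutes the twelve conics while multiplying
`t` by a cube root of unity, which reaches the other values.

The product of the nine conics is a norm over a group of diagonal matrices, hence a polynomial in
`x³, y³, z³` (`nineConics_one`, `nineConics_zero`). This makes explicit logarithmic fields of
degrees 7 and 13 (or 7 and 10) easy to check against Saito's determinant.

Saito's criterion (`isFreeCurve_of_hasSaitoBasis`) turns such a pair into a resolution. After
correction by the Euler field both members are syzygies of `∇f`, and their cross product is a
nonzero constant times `∇f`. As `f` is squarefree, the partial derivatives have no common factor
(`isUnit_of_dvd_pderiv`), so every syzygy is a polynomial combination of the two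
(`exists_combination`). -/

lemma exists_eq_mul_of_parallel {R : Type*} [CommRing R] [IsDomain R] [UniqueFactorizationMonoid R]
    {m w : Fin 3 → R} (hm : ∀ p, (∀ i, p ∣ m i) → IsUnit p)
    (hw : ∀ i j, w i * m j = w j * m i) : ∃ u, ∀ i, w i = u * m i := by
  classical
  let _ : GCDMonoid R := UniqueFactorizationMonoid.toGCDMonoid R
  obtain ⟨i₀, hi₀⟩ : ∃ i, m i ≠ 0 := by
    by_contra! h
    exact not_isUnit_zero (hm 0 fun i => by simp [h i])
  -- `m i₀` divides `w i₀ * m j` for every `j`, hence `w i₀` times the gcd of the entries of `m`,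
  -- which is a unit. The quotient `w i₀ / m i₀` is the required factor.
  have hdvd : ∀ j, m i₀ ∣ w i₀ * m j := fun j => ⟨w j, by rw [hw i₀ j, mul_comm]⟩
  have h1 : m i₀ ∣ w i₀ * gcd (m 0) (m 1) :=
    (dvd_gcd (hdvd 0) (hdvd 1)).trans (gcd_mul_left' _ _ _).dvd
  have h2 : m i₀ ∣ w i₀ * gcd (gcd (m 0) (m 1)) (m 2) :=
    (dvd_gcd h1 (hdvd 2)).trans (gcd_mul_left' _ _ _).dvd
  have hu : IsUnit (gcd (gcd (m 0) (m 1)) (m 2)) := by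
    refine hm _ fun i => ?_
    fin_cases i
    · exact (gcd_dvd_left _ _).trans (gcd_dvd_left _ _)
    · exact (gcd_dvd_left _ _).trans (gcd_dvd_right _ _)
    · exact gcd_dvd_right _ _
  obtain ⟨u, hu'⟩ := hu.dvd_mul_right.mp h2
  refine ⟨u, fun i => mul_left_cancel₀ hi₀ ?_⟩
  linear_combination m i * hu' - hw i₀ i

/-- If `a` and `b` are orthogonal to `g`, then `a × b` is proportional to `g`; the factor is found
by pairing with `x`. -/
lemma cross_eq_of_orthogonal {R : Type*} [CommRing R] [IsDomain R] {x a b g : Fin 3 → R}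
    {f n c : R} (hf : f ≠ 0)
    (ha : a 0 * g 0 + a 1 * g 1 + a 2 * g 2 = 0) (hb : b 0 * g 0 + b 1 * g 1 + b 2 * g 2 = 0)
    (hx : x 0 * g 0 + x 1 * g 1 + x 2 * g 2 = n * f)
    (hd : (Matrix.of ![x, a, b]).det = c * f) :
    n * (a 1 * b 2 - a 2 * b 1) = c * g 0 ∧ n * (a 2 * b 0 - a 0 * b 2) = c * g 1 ∧
      n * (a 0 * b 1 - a 1 * b 0) = c * g 2 := by
  simp only [Matrix.det_fin_three, Matrix.of_apply, Matrix.cons_val] at hd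
  -- Cramer's identity `det(x, a, b) g = (x·g) a×b + (a·g) b×x + (b·g) x×a`, in which the last two
  -- terms vanish.
  refine ⟨mul_left_cancel₀ hf ?_, mul_left_cancel₀ hf ?_, mul_left_cancel₀ hf ?_⟩
  · linear_combination g 0 * hd - (a 1 * b 2 - a 2 * b 1) * hx +
      (x 1 * b 2 - x 2 * b 1) * ha - (x 1 * a 2 - x 2 * a 1) * hb
  · linear_combination g 1 * hd - (a 2 * b 0 - a 0 * b 2) * hx +
      (x 2 * b 0 - x 0 * b 2) * ha - (x 2 * a 0 - x 0 * a 2) * hb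
  · linear_combination g 2 * hd - (a 0 * b 1 - a 1 * b 0) * hx +
      (x 0 * b 1 - x 1 * b 0) * ha - (x 0 * a 1 - x 1 * a 0) * hb

lemma eq_zero_of_cross_eq_zero {R : Type*} [CommRing R] [IsDomain R] {a b z : Fin 3 → R}
    (hm : a 1 * b 2 - a 2 * b 1 ≠ 0 ∨ a 2 * b 0 - a 0 * b 2 ≠ 0 ∨ a 0 * b 1 - a 1 * b 0 ≠ 0)
    (ha : ∀ i j, a i * z j = a j * z i) (hb : ∀ i j, b i * z j = b j * z i) : z = 0 := by
  have key : ∀ k i j, z k * (a i * b j - a j * b i) = 0 := fun k i j => by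
    linear_combination a i * hb j k - a j * hb i k + b k * ha i j
  funext k
  rcases hm with h | h | h
  · exact (mul_eq_zero.mp (key k 1 2)).resolve_right h
  · exact (mul_eq_zero.mp (key k 2 0)).resolve_right h
  · exact (mul_eq_zero.mp (key k 0 1)).resolve_right h

/-- A vector that is linearly dependent on `a`, `b` over the fraction field is a combination of
`a`, `b` as soon as `a × b` is primitive. -/
lemma exists_combination {R : Type*} [CommRing R] [IsDomain R] [UniqueFactorizationMonoid R]
    {a b v : Fin 3 → R}
    (hm : ∀ p, p ∣ a 1 * b 2 - a 2 * b 1 → p ∣ a 2 * b 0 - a 0 * b 2 →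
      p ∣ a 0 * b 1 - a 1 * b 0 → IsUnit p)
    (hv : v 0 * (a 1 * b 2 - a 2 * b 1) + v 1 * (a 2 * b 0 - a 0 * b 2) +
      v 2 * (a 0 * b 1 - a 1 * b 0) = 0) : ∃ s t, ∀ i, v i = s * a i + t * b i := by
  let m : Fin 3 → R := ![a 1 * b 2 - a 2 * b 1, a 2 * b 0 - a 0 * b 2, a 0 * b 1 - a 1 * b 0]
  have hm' : ∀ p, (∀ i, p ∣ m i) → IsUnit p := fun p hp => hm p (hp 0) (hp 1) (hp 2)
  -- If `v = s a + t b`, then `v × b = s (a × b)` and `a × v = t (a × b)`. Conversely both cross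
  -- products are parallel to `m = a × b`, because `v`, `a`, `b` are orthogonal to `m`; primitivity
  -- of `m` makes `s` and `t` elements of `R`.
  obtain ⟨s, hs⟩ := exists_eq_mul_of_parallel (m := m)
    (w := ![v 1 * b 2 - v 2 * b 1, v 2 * b 0 - v 0 * b 2, v 0 * b 1 - v 1 * b 0]) hm' (by
      intro i j
      fin_cases i <;> fin_cases j <;> simp [m]
      · linear_combination b 2 * hv
      · linear_combination (-b 1) * hv
      · linear_combination (-b 2) * hv
      · linear_combination b 0 * hv
      · linear_combination b 1 * hv
      · linear_combination (-b 0) * hv)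
  obtain ⟨t, ht⟩ := exists_eq_mul_of_parallel (m := m)
    (w := ![a 1 * v 2 - a 2 * v 1, a 2 * v 0 - a 0 * v 2, a 0 * v 1 - a 1 * v 0]) hm' (by
      intro i j
      fin_cases i <;> fin_cases j <;> simp [m]
      · linear_combination (-a 2) * hv
      · linear_combination a 1 * hv
      · linear_combination a 2 * hv
      · linear_combination (-a 0) * hv
      · linear_combination (-a 1) * hv
      · linear_combination a 0 * hv)
  have hs0 := hs 0
  have hs1 := hs 1
  have hs2 := hs 2
  have ht0 := ht 0
  have ht1 := ht 1
  have ht2 := ht 2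
  simp only [m, Matrix.cons_val] at hs0 hs1 hs2 ht0 ht1 ht2
  have hz : (fun i => v i - (s * a i + t * b i)) = 0 := by
    refine eq_zero_of_cross_eq_zero (a := a) (b := b) ?_ ?_ ?_
    · by_contra! h
      exact not_isUnit_zero (hm 0 (by simp [h.1]) (by simp [h.2.1]) (by simp [h.2.2]))
    · intro i j
      fin_cases i <;> fin_cases j <;> simp
      · linear_combination ht2
      · linear_combination -ht1
      · linear_combination -ht2
      · linear_combination ht0
      · linear_combination ht1
      · linear_combination -ht0
    · intro i j
      fin_cases i <;> fin_cases j <;> simp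
      · linear_combination -hs2
      · linear_combination hs1
      · linear_combination hs2
      · linear_combination -hs0
      · linear_combination -hs1
      · linear_combination hs0
  exact ⟨s, t, fun i => sub_eq_zero.mp (congrFun hz i)⟩

/-! ### Partial derivatives -/

lemma eq_C_of_pderiv_eq_zero {p : S} (h : ∀ i, pderiv i p = 0) : p = C (coeff 0 p) := by
  ext m
  rw [coeff_C]
  split_ifs with hm
  · rw [← hm]
  · obtain ⟨i, hi⟩ : ∃ i, m i ≠ 0 := by
      by_contra! h0
      exact hm (Finsupp.ext fun i => (h0 i).symm)
    have hle : Finsupp.single i 1 ≤ m := by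
      rw [Finsupp.single_le_iff]; omega
    have := congrArg (coeff (m - Finsupp.single i 1)) (h i)
    rw [coeff_pderiv, tsub_add_cancel_of_le hle, coeff_zero] at this
    refine (mul_eq_zero.mp this).resolve_right ?_
    exact Nat.cast_add_one_ne_zero _

/-- A nonzero derivative has smaller total degree than `p`, so `p` cannot divide it. -/
lemma pderiv_eq_zero_of_dvd {p : S} {i : Fin 3} (h : p ∣ pderiv i p) : pderiv i p = 0 := by
  by_contra hne
  have h1 := totalDegree_le_of_dvd_of_isDomain h hne
  obtain ⟨m, hm, hdeg⟩ : ∃ m ∈ (pderiv i p).support, (pderiv i p).totalDegree = m.sum fun _ e => e :=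
    Finset.exists_mem_eq_sup _ (by rwa [Finset.nonempty_iff_ne_empty, Ne, support_eq_empty]) _
  have hm' : m + Finsupp.single i 1 ∈ p.support := by
    rw [mem_support_iff, coeff_pderiv] at hm
    exact mem_support_iff.mpr (left_ne_zero_of_mul hm)
  have h2 := le_totalDegree hm'
  rw [Finsupp.sum_add_index' (by simp) (by simp), Finsupp.sum_single_index rfl] at h2
  omega

/-- By Euler's formula a common divisor of the partial derivatives divides `f`. For an irreducible
factor `q` of it write `f = q e`; squarefreeness gives `q ∤ e`, so the product rule forces `q` to
divide its own derivatives. These then vanish and `q` is constant. -/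
lemma isUnit_of_dvd_pderiv {f : S} {d : ℕ} (hd : d ≠ 0) (hf : f.IsHomogeneous d)
    (hsq : Squarefree f) {p : S} (hp : ∀ i, p ∣ pderiv i f) : IsUnit p := by
  by_contra hu
  have hdu : IsUnit ((d : ℕ) : S) := by
    have : IsUnit (C (d : ℂ) : S) := (IsUnit.mk0 (d : ℂ) (by exact_mod_cast hd)).map C
    simpa using this
  have hpf : p ∣ f := by
    refine hdu.dvd_mul_left.mp ?_
    rw [← nsmul_eq_mul, ← hf.sum_X_mul_pderiv]
    exact Finset.dvd_sum fun i _ => (hp i).mul_left _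
  have hp0 : p ≠ 0 := fun h => hsq.ne_zero (zero_dvd_iff.mp (h ▸ hpf))
  obtain ⟨q, hq, hqp⟩ := WfDvdMonoid.exists_irreducible_factor hu hp0
  obtain ⟨e, he⟩ := hqp.trans hpf
  have hqe : ¬ q ∣ e := fun h => hq.not_isUnit (hsq q (he ▸ mul_dvd_mul_left q h))
  have hq0 : ∀ i, pderiv i q = 0 := fun i => by
    refine pderiv_eq_zero_of_dvd (((hq.prime.dvd_or_dvd ?_).resolve_right hqe))
    have := hqp.trans (hp i)
    rw [he, pderiv_mul] at this
    exact (dvd_add_left (dvd_mul_right q _)).mp this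
  have hc := eq_C_of_pderiv_eq_zero hq0
  refine hq.not_isUnit (hc ▸ IsUnit.map C (IsUnit.mk0 _ fun h => hq.ne_zero ?_))
  rw [hc, h, C_0]

lemma gradientMap_apply (f : S) (v : Fin 3 → S) :
    gradientMap f v = v 0 * pderiv 0 f + v 1 * pderiv 1 f + v 2 * pderiv 2 f := by
  simp [gradientMap, Fintype.linearCombination_apply, Fin.sum_univ_three]

lemma relationMap_apply (r : Fin 2 → Fin 3 → S) (w : Fin 2 → S) (i : Fin 3) :
    relationMap r w i = w 0 * r 0 i + w 1 * r 1 i := by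
  simp [relationMap, Fintype.linearCombination_apply, Fin.sum_univ_two]

lemma constantCoeff_eq_zero_of_isHomogeneous {p : S} {n : ℕ} (h : p.IsHomogeneous n) (hn : n ≠ 0) :
    constantCoeff p = 0 := by
  rw [constantCoeff_eq]
  exact h.coeff_eq_zero (by simpa using hn.symm)

/-! ### Saito's criterion -/

/-- Two homogeneous logarithmic vector fields `a`, `b` along `f = 0` which, together with the Euler
field, satisfy Saito's determinantal condition. -/
def HasSaitoBasis (f : S) (d₁ d₂ : ℕ) : Prop :=
  f.IsHomogeneous (d₁ + d₂ + 1) ∧ ∃ (a b : Fin 3 → S) (h k : S) (c : ℂ), c ≠ 0 ∧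
    (∀ i, (a i).IsHomogeneous d₁) ∧ (∀ i, (b i).IsHomogeneous d₂) ∧
    h.IsHomogeneous (d₁ - 1) ∧ k.IsHomogeneous (d₂ - 1) ∧
    gradientMap f a = h * f ∧ gradientMap f b = k * f ∧
    (Matrix.of ![X, a, b]).det = C c * f

/-- Subtracting a multiple of the Euler field turns a logarithmic field into a syzygy. -/
lemma gradientMap_sub_euler {f : S} {d : ℕ} (hd : d ≠ 0) (hf : f.IsHomogeneous d) {a : Fin 3 → S}
    {h : S} (ha : gradientMap f a = h * f) :
    gradientMap f (fun i => a i - C (d : ℂ)⁻¹ * h * X i) = 0 := by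
  have hE := hf.sum_X_mul_pderiv
  rw [Fin.sum_univ_three, nsmul_eq_mul] at hE
  have hC : (C (d : ℂ)⁻¹ : S) * (d : S) = 1 := by
    rw [← map_natCast (C : ℂ →+* S), ← C_mul, inv_mul_cancel₀ (by exact_mod_cast hd), C_1]
  rw [gradientMap_apply] at ha ⊢
  linear_combination ha - C (d : ℂ)⁻¹ * h * hE - h * f * hC

theorem isFreeCurve_of_hasSaitoBasis {f : S} {d₁ d₂ : ℕ} (h₁ : 1 ≤ d₁) (h₁₂ : d₁ ≤ d₂)
    (hsq : Squarefree f) (H : HasSaitoBasis f d₁ d₂) : IsFreeCurve f d₁ d₂ := by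
  obtain ⟨hf, a, b, h, k, c, hc, ha, hb, hh, hk, hah, hbk, hdet⟩ := H
  set d := d₁ + d₂ + 1 with hd
  have hd0 : d ≠ 0 := by omega
  have hf0 : f ≠ 0 := hsq.ne_zero
  let r : Fin 2 → Fin 3 → S :=
    ![fun i => a i - C (d : ℂ)⁻¹ * h * X i, fun i => b i - C (d : ℂ)⁻¹ * k * X i]
  have hr0 : ∀ i, r 0 i = a i - C (d : ℂ)⁻¹ * h * X i := fun _ => rfl
  have hr1 : ∀ i, r 1 i = b i - C (d : ℂ)⁻¹ * k * X i := fun _ => rfl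
  have hg0 : gradientMap f (r 0) = 0 := gradientMap_sub_euler hd0 hf hah
  have hg1 : gradientMap f (r 1) = 0 := gradientMap_sub_euler hd0 hf hbk
  have hE := hf.sum_X_mul_pderiv
  rw [Fin.sum_univ_three, nsmul_eq_mul] at hE
  have hdet' : (Matrix.of ![X, r 0, r 1]).det = C c * f := by
    rw [← hdet]
    simp only [Matrix.det_fin_three, Matrix.of_apply, Matrix.cons_val, hr0, hr1]
    ring
  have hg0' := hg0
  have hg1' := hg1
  rw [gradientMap_apply] at hg0' hg1'
  -- Pairing with the Euler field gives `d (r 0 × r 1) = c ∇f`, so the cross product inherits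
  -- primitivity from the gradient.
  obtain ⟨m0, m1, m2⟩ := cross_eq_of_orthogonal (g := fun i => pderiv i f) hf0 hg0' hg1' hE hdet'
  have hdu : IsUnit ((d : ℕ) : S) := by
    have : IsUnit (C (d : ℂ) : S) := (IsUnit.mk0 (d : ℂ) (by exact_mod_cast hd0)).map C
    simpa using this
  have hcu : IsUnit (C c : S) := (IsUnit.mk0 c hc).map C
  have hprim : ∀ p, p ∣ r 0 1 * r 1 2 - r 0 2 * r 1 1 → p ∣ r 0 2 * r 1 0 - r 0 0 * r 1 2 →
      p ∣ r 0 0 * r 1 1 - r 0 1 * r 1 0 → IsUnit p := by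
    intro p hp0 hp1 hp2
    refine isUnit_of_dvd_pderiv hd0 hf hsq (p := p) fun i => ?_
    fin_cases i
    · exact hcu.dvd_mul_left.mp (m0 ▸ hp0.mul_left _)
    · exact hcu.dvd_mul_left.mp (m1 ▸ hp1.mul_left _)
    · exact hcu.dvd_mul_left.mp (m2 ▸ hp2.mul_left _)
  have hhom : ∀ {n : ℕ} {v : Fin 3 → S} {l : S}, 1 ≤ n → (∀ i, (v i).IsHomogeneous n) →
      l.IsHomogeneous (n - 1) → ∀ i, (v i - C (d : ℂ)⁻¹ * l * X i).IsHomogeneous n := by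
    intro n v l hn hv hl i
    refine (hv i).sub ?_
    have := (hl.C_mul (d : ℂ)⁻¹).mul (isHomogeneous_X ℂ i)
    rwa [Nat.sub_add_cancel hn] at this
  have hhr0 : ∀ i, (r 0 i).IsHomogeneous d₁ := hhom h₁ ha hh
  have hhr1 : ∀ i, (r 1 i).IsHomogeneous d₂ := hhom (h₁.trans h₁₂) hb hk
  refine ⟨hsq, d, ⟨hf, h₁, h₁₂, r, hhr0, hhr1, ?_, ?_, ?_, Ideal.Quotient.mk_surjective, ?_, ?_⟩, rfl⟩
  · rw [← LinearMap.ker_eq_bot, LinearMap.ker_eq_bot']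
    intro w hw
    have hw' : ∀ i, w 0 * r 0 i + w 1 * r 1 i = 0 := fun i => by
      rw [← relationMap_apply, hw]; rfl
    by_contra hne
    have hz : w 0 = 0 ∧ w 1 = 0 := by
      have e0 : ∀ i j, w 0 * (r 0 i * r 1 j - r 0 j * r 1 i) = 0 := fun i j => by
        linear_combination r 1 j * hw' i - r 1 i * hw' j
      have e1 : ∀ i j, w 1 * (r 0 i * r 1 j - r 0 j * r 1 i) = 0 := fun i j => by
        linear_combination r 0 i * hw' j - r 0 j * hw' i
      constructor
      · by_contra h0
        have z := fun i j => (mul_eq_zero.mp (e0 i j)).resolve_left h0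
        exact not_isUnit_zero (hprim 0 (by rw [z]) (by rw [z]) (by rw [z]))
      · by_contra h0
        have z := fun i j => (mul_eq_zero.mp (e1 i j)).resolve_left h0
        exact not_isUnit_zero (hprim 0 (by rw [z]) (by rw [z]) (by rw [z]))
    exact hne (funext fun i => by fin_cases i <;> simp [hz])
  · intro v
    constructor
    · intro hv
      rw [gradientMap_apply] at hv
      obtain ⟨s, t, hst⟩ := exists_combination (a := r 0) (b := r 1) (v := v) hprim (by
        refine hdu.mul_left_cancel ?_
        linear_combination C c * hv + v 0 * m0 + v 1 * m1 + v 2 * m2)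
      exact ⟨![s, t], funext fun i => by rw [relationMap_apply, hst]; simp⟩
    · rintro ⟨w, rfl⟩
      have hw : relationMap r w = w 0 • r 0 + w 1 • r 1 :=
        funext fun i => by rw [relationMap_apply]; rfl
      rw [hw, map_add, map_smul, map_smul, hg0, hg1, smul_zero, smul_zero, add_zero]
  · intro p
    rw [Ideal.Quotient.eq_zero_iff_mem, jacobianIdeal, Ideal.mem_span_range_iff_exists_fun]
    simp [gradientMap, Fintype.linearCombination_apply]
  · intro i j
    fin_cases i
    · exact constantCoeff_eq_zero_of_isHomogeneous (hhr0 j) (by omega)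
    · exact constantCoeff_eq_zero_of_isHomogeneous (hhr1 j) (by omega)
  · intro i
    exact constantCoeff_eq_zero_of_isHomogeneous (n := d - 1) hf.pderiv (by omega)

/-! ### Linear changes of coordinates -/

/-- The substitution of the linear forms with coefficients the rows of `M` for the variables. -/
def linearSubst (M : Matrix (Fin 3) (Fin 3) ℂ) : S →ₐ[ℂ] S :=
  aeval fun i => ∑ j, C (M i j) * X j

@[simp]
lemma linearSubst_X (M : Matrix (Fin 3) (Fin 3) ℂ) (i : Fin 3) :
    linearSubst M (X i) = ∑ j, C (M i j) * X j := by
  simp [linearSubst]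

@[simp]
lemma linearSubst_C (M : Matrix (Fin 3) (Fin 3) ℂ) (c : ℂ) : linearSubst M (C c) = C c := by
  simp [linearSubst]

/-- `linearSubst M f` is `f(Mx)`, so composition reverses the order of the matrices. -/
lemma linearSubst_linearSubst {M N : Matrix (Fin 3) (Fin 3) ℂ} (f : S) :
    linearSubst M (linearSubst N f) = linearSubst (N * M) f := by
  suffices (linearSubst M).comp (linearSubst N) = linearSubst (N * M) from
    DFunLike.congr_fun this f
  refine algHom_ext fun i => ?_
  simp only [AlgHom.comp_apply, linearSubst_X, map_sum, map_mul, linearSubst_C, Matrix.mul_apply,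
    Finset.sum_mul, Finset.mul_sum]
  rw [Finset.sum_comm]
  simp only [mul_assoc]

lemma linearSubst_one (f : S) : linearSubst 1 f = f := by
  have : linearSubst 1 = AlgHom.id ℂ S := by
    refine algHom_ext fun i => ?_
    simp only [linearSubst_X, AlgHom.id_apply, Matrix.one_apply, Fin.sum_univ_three]
    fin_cases i <;> simp
  rw [this, AlgHom.id_apply]

/-- An invertible linear change of coordinates. -/
def linearSubstEquiv (M N : Matrix (Fin 3) (Fin 3) ℂ) (hMN : M * N = 1) (hNM : N * M = 1) :
    S ≃ₐ[ℂ] S :=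
  AlgEquiv.ofAlgHom (linearSubst M) (linearSubst N)
    (AlgHom.ext fun f => by
      rw [AlgHom.comp_apply, linearSubst_linearSubst, hNM, linearSubst_one, AlgHom.id_apply])
    (AlgHom.ext fun f => by
      rw [AlgHom.comp_apply, linearSubst_linearSubst, hMN, linearSubst_one, AlgHom.id_apply])

lemma squarefree_linearSubst {M N : Matrix (Fin 3) (Fin 3) ℂ} (hMN : M * N = 1) (hNM : N * M = 1)
    {f : S} (hf : Squarefree f) : Squarefree (linearSubst M f) := by
  intro p hp
  let σ := linearSubstEquiv M N hMN hNM
  have h := map_dvd σ.symm hp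
  rw [map_mul, show linearSubst M f = σ f from rfl, AlgEquiv.symm_apply_apply] at h
  exact (MulEquiv.isUnit_map σ.symm).mp (hf _ h)

lemma isHomogeneous_linearSubst (M : Matrix (Fin 3) (Fin 3) ℂ) {f : S} {n : ℕ}
    (hf : f.IsHomogeneous n) : (linearSubst M f).IsHomogeneous n := by
  have := hf.aeval (n := 1) (fun i => ∑ j, C (M i j) * X j) fun i =>
    IsHomogeneous.sum _ _ _ fun j _ => isHomogeneous_C_mul_X (M i j) j
  rwa [one_mul] at this

lemma pderiv_linearSubst (M : Matrix (Fin 3) (Fin 3) ℂ) (i : Fin 3) (f : S) :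
    pderiv i (linearSubst M f) = ∑ j, C (M j i) * linearSubst M (pderiv j f) := by
  induction f using MvPolynomial.induction_on with
  | C c => simp
  | add p q hp hq => simp only [map_add, hp, hq, mul_add, Finset.sum_add_distrib]
  | mul_X p k hp =>
    rw [map_mul, pderiv_mul, hp]
    simp only [pderiv_mul, map_add, map_mul, mul_add, Finset.sum_add_distrib, pderiv_X]
    congr 1
    · rw [Finset.sum_mul]; simp only [mul_assoc]
    · simp only [linearSubst_X, map_sum, pderiv_C_mul, pderiv_X, Pi.single_apply]
      simp [mul_comm, Finset.sum_ite_eq]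

/-- A vector field `v` is transported to `N v(Mx)` with `N = M⁻¹`. By the chain rule its cofactor is
composed with `M`; the Euler field is invariant, and Saito's determinant acquires the factor `det
N`. -/
lemma HasSaitoBasis.linearSubst {M N : Matrix (Fin 3) (Fin 3) ℂ} (hMN : M * N = 1)
    (hNM : N * M = 1) {f : S} {d₁ d₂ : ℕ} (H : HasSaitoBasis f d₁ d₂) :
    HasSaitoBasis (linearSubst M f) d₁ d₂ := by
  obtain ⟨hf, a, b, h, k, c, hc, ha, hb, hh, hk, hah, hbk, hdet⟩ := H
  set σ := HesseConics.linearSubst M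
  have hX : ∀ i, X i = ∑ j, C (N i j) * σ (X j) := fun i => by
    have := linearSubst_linearSubst (M := M) (N := N) (X i)
    rw [hNM, linearSubst_one, linearSubst_X] at this
    rw [← this]
    simp [σ]
  have hgrad : ∀ v : Fin 3 → S, gradientMap (σ f) (fun i => ∑ j, C (N i j) * σ (v j)) =
      σ (gradientMap f v) := by
    intro v
    have e : ∀ i j, (∑ k, C (M i k) * C (N k j) : S) = if i = j then 1 else 0 := fun i j => by
      have := congrArg (fun z => (C z : S)) (congrFun (congrFun hMN i) j)
      simp only [Matrix.mul_apply, map_sum, Matrix.one_apply] at this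
      simp only [map_mul] at this
      rw [this]
      split_ifs <;> simp
    simp only [Fin.sum_univ_three] at e
    simp only [gradientMap_apply, σ, pderiv_linearSubst, map_add, map_mul, Fin.sum_univ_three]
    have h00 := e 0 0
    have h01 := e 0 1
    have h02 := e 0 2
    have h10 := e 1 0
    have h11 := e 1 1
    have h12 := e 1 2
    have h20 := e 2 0
    have h21 := e 2 1
    have h22 := e 2 2
    simp at h00 h01 h02 h10 h11 h12 h20 h21 h22
    generalize HesseConics.linearSubst M (v 0) = v0
    generalize HesseConics.linearSubst M (v 1) = v1
    generalize HesseConics.linearSubst M (v 2) = v2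
    generalize HesseConics.linearSubst M (pderiv 0 f) = g0
    generalize HesseConics.linearSubst M (pderiv 1 f) = g1
    generalize HesseConics.linearSubst M (pderiv 2 f) = g2
    linear_combination v0 * g0 * h00 + v1 * g0 * h01 + v2 * g0 * h02 + v0 * g1 * h10 +
      v1 * g1 * h11 + v2 * g1 * h12 + v0 * g2 * h20 + v1 * g2 * h21 + v2 * g2 * h22
  have hhom : ∀ {n : ℕ} {v : Fin 3 → S}, (∀ i, (v i).IsHomogeneous n) →
      ∀ i, (∑ j, C (N i j) * σ (v j)).IsHomogeneous n := fun hv i =>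
    IsHomogeneous.sum _ _ _ fun j _ => (isHomogeneous_linearSubst M (hv j)).C_mul _
  have hNdet : N.det ≠ 0 := fun h0 => by
    have := congrArg Matrix.det hNM
    rw [Matrix.det_mul, h0, zero_mul, Matrix.det_one] at this
    exact zero_ne_one this
  refine ⟨isHomogeneous_linearSubst M hf, fun i => ∑ j, C (N i j) * σ (a j),
    fun i => ∑ j, C (N i j) * σ (b j), σ h, σ k, c * N.det, mul_ne_zero hc hNdet, hhom ha, hhom hb,
    isHomogeneous_linearSubst M hh, isHomogeneous_linearSubst M hk, ?_, ?_, ?_⟩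
  · rw [hgrad, hah, map_mul]
  · rw [hgrad, hbk, map_mul]
  · have hmat : (Matrix.of ![X, fun i => ∑ j, C (N i j) * σ (a j),
        fun i => ∑ j, C (N i j) * σ (b j)] : Matrix (Fin 3) (Fin 3) S) =
        (σ : S →+* S).mapMatrix (Matrix.of ![X, a, b]) * ((C : ℂ →+* S).mapMatrix N).transpose := by
      ext1 i j
      rw [Matrix.mul_apply]
      fin_cases i
      · simpa [mul_comm] using hX j
      · simp [mul_comm]
      · simp [mul_comm]
    rw [hmat, Matrix.det_mul, Matrix.det_transpose, ← RingHom.map_det, ← RingHom.map_det, hdet]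
    simp [σ]
    ring

lemma HasSaitoBasis.C_mul {f : S} {d₁ d₂ : ℕ} (H : HasSaitoBasis f d₁ d₂) {u : ℂ} (hu : u ≠ 0) :
    HasSaitoBasis (C u * f) d₁ d₂ := by
  obtain ⟨hf, a, b, h, k, c, hc, ha, hb, hh, hk, hah, hbk, hdet⟩ := H
  refine ⟨hf.C_mul u, a, b, h, k, c * u⁻¹, mul_ne_zero hc (inv_ne_zero hu), ha, hb, hh, hk, ?_, ?_, ?_⟩
  · rw [gradientMap_apply] at hah ⊢
    simp only [pderiv_C_mul]
    linear_combination C u * hah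
  · rw [gradientMap_apply] at hbk ⊢
    simp only [pderiv_C_mul]
    linear_combination C u * hbk
  · rw [hdet, ← mul_assoc, ← MvPolynomial.C_mul, mul_assoc, inv_mul_cancel₀ hu, mul_one]

/-! ### Smooth conics -/

/-- The discriminant of a conic, the determinant of its Hessian matrix. -/
def quadricDisc (a b c e g h : ℂ) : ℂ :=
  8 * a * g * h + 2 * b * c * e - 2 * a * e ^ 2 - 2 * g * c ^ 2 - 2 * h * b ^ 2

lemma isHomogeneous_quadric (a b c e g h : ℂ) : (quadric a b c e g h).IsHomogeneous 2 := by
  have hp : ∀ i, ((X i : S) ^ 2).IsHomogeneous 2 := fun i => isHomogeneous_X_pow i 2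
  have hm : ∀ i j, ((X i : S) * X j).IsHomogeneous 2 := fun i j =>
    (isHomogeneous_X ℂ i).mul (isHomogeneous_X ℂ j)
  exact ((((((hp 0).C_mul _).add ((hm 0 1).C_mul _)).add ((hm 0 2).C_mul _)).add
    ((hm 1 2).C_mul _)).add ((hp 1).C_mul _)).add ((hp 2).C_mul _)

lemma eval_quadric (a b c e g h : ℂ) (v : Fin 3 → ℂ) : eval v (quadric a b c e g h) =
    a * v 0 ^ 2 + b * (v 0 * v 1) + c * (v 0 * v 2) + e * (v 1 * v 2) + g * v 1 ^ 2 + h * v 2 ^ 2 := by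
  simp [quadric]

lemma eval_pderiv_quadric (a b c e g h : ℂ) (v : Fin 3 → ℂ) (i : Fin 3) :
    eval v (pderiv i (quadric a b c e g h)) =
      Matrix.mulVec !![2 * a, b, c; b, 2 * g, e; c, e, 2 * h] v i := by
  fin_cases i <;>
  · simp [quadric, pderiv_X, Matrix.mulVec, dotProduct, Fin.sum_univ_three]
    ring

/-- The gradient of a quadric at `v` is its Hessian matrix applied to `v`. By Euler's formula a
kernel vector automatically lies on the conic, so singular points are exactly nonzero kernel
vectors. -/
lemma isSmoothCurve_quadric_iff (a b c e g h : ℂ) :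
    IsSmoothCurve (quadric a b c e g h) ↔ quadricDisc a b c e g h ≠ 0 := by
  have hdet : quadricDisc a b c e g h = (!![2 * a, b, c; b, 2 * g, e; c, e, 2 * h]).det := by
    simp [Matrix.det_fin_three, quadricDisc]
    ring
  rw [hdet, Ne, ← Matrix.exists_mulVec_eq_zero_iff]
  push Not
  refine forall_congr' fun v => forall_congr' fun hv => ?_
  constructor
  · intro hs h0
    have hd : ∀ i, eval v (pderiv i (quadric a b c e g h)) = 0 := fun i => by
      rw [eval_pderiv_quadric, h0]; rfl
    have hE := congrArg (eval v) (isHomogeneous_quadric a b c e g h).sum_X_mul_pderiv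
    simp only [map_sum, map_mul, hd, mul_zero, Finset.sum_const_zero, map_nsmul] at hE
    obtain ⟨i, hi⟩ := hs (by simpa using hE.symm)
    exact hi (hd i)
  · intro hne _
    by_contra! hd
    exact hne (funext fun i => by rw [← eval_pderiv_quadric, hd]; rfl)

lemma eval_eq_sum_of_isHomogeneous_one {p : S} (hp : p.IsHomogeneous 1) :
    ∃ l : (Fin 3 → ℂ) →ₗ[ℂ] ℂ, ∀ v, eval v p = l v := by
  rw [← mem_homogeneousSubmodule, homogeneousSubmodule_one_eq_span_X] at hp
  induction hp using Submodule.span_induction with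
  | mem x hx =>
    obtain ⟨i, rfl⟩ := hx
    exact ⟨LinearMap.proj i, fun v => by simp⟩
  | zero => exact ⟨0, fun v => by simp⟩
  | add p q _ _ hp hq =>
    obtain ⟨l, hl⟩ := hp
    obtain ⟨m, hm⟩ := hq
    exact ⟨l + m, fun v => by simp [hl, hm]⟩
  | smul c p _ hp =>
    obtain ⟨l, hl⟩ := hp
    exact ⟨c • l, fun v => by simp [hl, smul_eval]⟩

/-- Two linear forms in three variables have a common nonzero zero, and the product is singular
there. -/
lemma not_isSmoothCurve_mul {p q : S} (hp : p.IsHomogeneous 1) (hq : q.IsHomogeneous 1) :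
    ¬ IsSmoothCurve (p * q) := by
  intro hs
  obtain ⟨l, hl⟩ := eval_eq_sum_of_isHomogeneous_one hp
  obtain ⟨m, hm⟩ := eval_eq_sum_of_isHomogeneous_one hq
  obtain ⟨v, hv, hv0⟩ : ∃ v ∈ LinearMap.ker (l.prod m), v ≠ 0 := by
    refine Submodule.exists_mem_ne_zero_of_ne_bot (LinearMap.ker_ne_bot_of_finrank_lt ?_)
    simp
  have hv' : (l v, m v) = (0, 0) := hv
  rw [Prod.mk.injEq] at hv'
  obtain ⟨i, hi⟩ := hs v hv0 (by rw [map_mul, hl, hv'.1, zero_mul])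
  exact hi (by rw [pderiv_mul, map_add, map_mul, map_mul, hl, hm, hv'.1, hv'.2]; ring)

lemma eq_C_add_of_totalDegree_eq_one {p : S} (hp : p.totalDegree = 1) :
    p = C (coeff 0 p) + homogeneousComponent 1 p := by
  conv_lhs => rw [← sum_homogeneousComponent p, hp]
  simp [Finset.sum_range_succ, homogeneousComponent_zero]

lemma IsSmoothCurve.irreducible {g : S} (hg : g.IsHomogeneous 2) (hs : IsSmoothCurve g) :
    Irreducible g := by
  have hg0 : g ≠ 0 := by
    rintro rfl
    obtain ⟨i, hi⟩ := hs (fun _ => 1) (fun h => one_ne_zero (congrFun h 0)) (by simp)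
    simp at hi
  have hdeg := hg.totalDegree hg0
  refine ⟨fun hu => ?_, fun p q hpq => ?_⟩
  · have := (isUnit_iff_totalDegree_of_isReduced.mp hu).2
    omega
  · have hp0 : p ≠ 0 := by rintro rfl; simp [hpq] at hg0
    have hq0 : q ≠ 0 := by rintro rfl; simp [hpq] at hg0
    have hunit : ∀ r : S, r ≠ 0 → r.totalDegree = 0 → IsUnit r := fun r hr h => by
      rw [totalDegree_eq_zero_iff_eq_C] at h
      rw [h] at hr ⊢
      exact (IsUnit.mk0 _ fun h0 => hr (by rw [h0, C_0])).map C
    have hsum : p.totalDegree + q.totalDegree = 2 := by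
      rw [← totalDegree_mul_of_isDomain hp0 hq0, ← hpq, hdeg]
    by_contra! hne
    have hp1 : p.totalDegree ≠ 0 := fun h => hne.1 (hunit p hp0 h)
    have hq1 : q.totalDegree ≠ 0 := fun h => hne.2 (hunit q hq0 h)
    have ep := eq_C_add_of_totalDegree_eq_one (p := p) (by omega)
    have eq := eq_C_add_of_totalDegree_eq_one (p := q) (by omega)
    have hhp := homogeneousComponent_isHomogeneous 1 p
    have hhq := homogeneousComponent_isHomogeneous 1 q
    generalize homogeneousComponent 1 p = p₁ at ep hhp
    generalize homogeneousComponent 1 q = q₁ at eq hhq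
    -- The two factors of degree one need not be homogeneous a priori. Comparing components of
    -- degree two replaces them by their linear parts, so that `g = p₁ q₁`.
    have hsplit : g = C (coeff 0 p * coeff 0 q) + (C (coeff 0 p) * q₁ + C (coeff 0 q) * p₁) +
        p₁ * q₁ := by
      rw [C_mul]
      linear_combination hpq + q * ep + (C (coeff 0 p) + p₁) * eq
    have h2 := congrArg (homogeneousComponent 2) hsplit
    rw [map_add, map_add, homogeneousComponent_of_mem (n := 2) hg,
      homogeneousComponent_of_mem (n := 1 + 1) (hhp.mul hhq),
      homogeneousComponent_of_mem (n := 0) (isHomogeneous_C _ _),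
      homogeneousComponent_of_mem (n := 1) ((hhq.C_mul _).add (hhp.C_mul _))] at h2
    simp only [if_true, OfNat.ofNat_ne_zero, OfNat.ofNat_ne_one, if_false, zero_add] at h2
    exact not_isSmoothCurve_mul hhp hhq (h2 ▸ hs)

/-! ### Nine conics permuted by the diagonal matrices of order three -/

section CubeRoot

variable {ω : ℂ}

lemma ne_zero_of_cubeRoot (hω : ω ^ 2 + ω + 1 = 0) : ω ≠ 0 := by
  rintro rfl; norm_num at hω

lemma ne_one_of_cubeRoot (hω : ω ^ 2 + ω + 1 = 0) : ω ≠ 1 := by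
  rintro rfl; norm_num at hω

lemma pow_injective_of_cubeRoot (hω : ω ^ 2 + ω + 1 = 0) {i j : Fin 3}
    (h : ω ^ (i : ℕ) = ω ^ (j : ℕ)) : i = j := by
  have h0 := ne_zero_of_cubeRoot hω
  have h1 : ω - 1 ≠ 0 := sub_ne_zero.mpr (ne_one_of_cubeRoot hω)
  have h2 : ω ^ 2 - 1 ≠ 0 := fun h => by
    have : ω = -2 := by linear_combination hω - h
    subst this; norm_num at h
  fin_cases i <;> fin_cases j <;> first | rfl | skip
  all_goals exfalso; simp only [pow_zero, pow_one] at h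
  · exact h1 (by linear_combination -h)
  · exact h2 (by linear_combination -h)
  · exact h1 (by linear_combination h)
  · exact mul_ne_zero h0 h1 (by linear_combination -h)
  · exact h2 (by linear_combination h)
  · exact mul_ne_zero h0 h1 (by linear_combination h)

end CubeRoot

/-- The conic `e (x² + y² + z²) + xy + xz + yz` after `y ↦ ωⁱ y`, `z ↦ ωʲ z`. -/
def diagConic (ω e : ℂ) (i j : Fin 3) : S :=
  quadric e (ω ^ (i : ℕ)) (ω ^ (j : ℕ)) (ω ^ (i : ℕ) * ω ^ (j : ℕ)) (e * (ω ^ (i : ℕ)) ^ 2)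
    (e * (ω ^ (j : ℕ)) ^ 2)

/-- The union of the nine conics `diagConic ω e i j`. -/
def nineConics (ω e : ℂ) : S := ∏ i, ∏ j, diagConic ω e i j

section NineConics

variable {ω e : ℂ}

/-- The hypothesis on `e` excludes the zeros of `8e³ - 6e + 2 = 2(e + 1)(2e - 1)²`, which is the
discriminant up to a power of `ω`. -/
lemma irreducible_diagConic (hω : ω ^ 2 + ω + 1 = 0) (he : 8 * e ^ 3 - 6 * e + 2 ≠ 0)
    (i j : Fin 3) : Irreducible (diagConic ω e i j) := by
  refine IsSmoothCurve.irreducible (isHomogeneous_quadric ..) ?_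
  rw [diagConic, isSmoothCurve_quadric_iff]
  have h0 := ne_zero_of_cubeRoot hω
  have : quadricDisc e (ω ^ (i : ℕ)) (ω ^ (j : ℕ)) (ω ^ (i : ℕ) * ω ^ (j : ℕ))
      (e * (ω ^ (i : ℕ)) ^ 2) (e * (ω ^ (j : ℕ)) ^ 2) =
      (8 * e ^ 3 - 6 * e + 2) * (ω ^ (i : ℕ) * ω ^ (j : ℕ)) ^ 2 := by
    rw [quadricDisc]; ring
  rw [this]
  exact mul_ne_zero he (pow_ne_zero _ (mul_ne_zero (pow_ne_zero _ h0) (pow_ne_zero _ h0)))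

lemma Associated.exists_C_mul {p q : S} (h : Associated p q) : ∃ u : ℂ, q = C u * p := by
  obtain ⟨⟨v, _, hv, _⟩, rfl⟩ := h
  obtain ⟨u, _, hu⟩ := isUnit_iff_eq_C_of_isReduced.mp (IsUnit.of_mul_eq_one _ hv)
  exact ⟨u, by rw [← hu, mul_comm]⟩

lemma eq_of_associated_diagConic (hω : ω ^ 2 + ω + 1 = 0) {i j i' j' : Fin 3}
    (h : Associated (diagConic ω e i j) (diagConic ω e i' j')) : i = i' ∧ j = j' := by
  obtain ⟨u, hu⟩ := Associated.exists_C_mul h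
  have h0 := ne_zero_of_cubeRoot hω
  have key : ∀ v : Fin 3 → ℂ, _ := fun v => congrArg (eval v) hu
  simp only [diagConic, map_mul, eval_C, eval_quadric] at key
  -- Differences of values at `(1, ±1, 0)` and the like isolate the mixed coefficients `ωⁱ`, `ωʲ`,
  -- `ωⁱωʲ`. All three scale by `u`, so `u² = u` and `u = 1`; the squares, which disappear for `e =
  -- 0`, are not needed.
  have k1 := key ![1, 1, 0]
  have k2 := key ![1, -1, 0]
  have k3 := key ![1, 0, 1]
  have k4 := key ![1, 0, -1]
  have k5 := key ![0, 1, 1]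
  have k6 := key ![0, 1, -1]
  simp only [Matrix.cons_val] at k1 k2 k3 k4 k5 k6
  have hi : ω ^ (i' : ℕ) = u * ω ^ (i : ℕ) := by linear_combination (k1 - k2) / 2
  have hj : ω ^ (j' : ℕ) = u * ω ^ (j : ℕ) := by linear_combination (k3 - k4) / 2
  have hij : ω ^ (i' : ℕ) * ω ^ (j' : ℕ) = u * (ω ^ (i : ℕ) * ω ^ (j : ℕ)) := by
    linear_combination (k5 - k6) / 2
  have hu0 : u ≠ 0 := by
    rintro rfl
    rw [zero_mul] at hi
    exact pow_ne_zero _ h0 hi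
  have hu1 : u = 1 := by
    refine mul_left_cancel₀ (mul_ne_zero hu0 (mul_ne_zero (pow_ne_zero (i : ℕ) h0)
      (pow_ne_zero (j : ℕ) h0))) ?_
    rw [hi, hj] at hij
    linear_combination hij
  rw [hu1, one_mul] at hi hj
  exact ⟨(pow_injective_of_cubeRoot hω hi).symm, (pow_injective_of_cubeRoot hω hj).symm⟩

lemma Irreducible.isRelPrime_of_not_associated {p q : S} (hp : Irreducible p) (hq : Irreducible q)
    (h : ¬ Associated p q) : IsRelPrime p q :=
  hp.isRelPrime_iff_not_dvd.mpr fun hd => h ((hp.dvd_irreducible_iff_associated hq).mp hd)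

lemma squarefree_nineConics_mul_lines (hω : ω ^ 2 + ω + 1 = 0) (he : 8 * e ^ 3 - 6 * e + 2 ≠ 0) :
    Squarefree (nineConics ω e * ∏ i, (X i : S)) := by
  have hX : ∀ i, Irreducible (X i : S) := fun i => (X_prime (R := ℂ) (i := i)).irreducible
  rw [squarefree_mul_iff]
  refine ⟨?_, ?_, ?_⟩
  · refine IsRelPrime.prod_left fun i _ => IsRelPrime.prod_left fun j _ =>
      IsRelPrime.prod_right fun k _ => ?_
    refine Irreducible.isRelPrime_of_not_associated (irreducible_diagConic hω he i j) (hX k)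
      fun h => ?_
    obtain ⟨u, hu⟩ := Associated.exists_C_mul h
    have h2 : (X k : S).IsHomogeneous 2 := by
      rw [hu]; exact (isHomogeneous_quadric ..).C_mul u
    have := (isHomogeneous_X ℂ k).inj_right h2 (hX k).ne_zero
    omega
  · rw [nineConics, ← Fintype.prod_prod_type' (f := fun i j => diagConic ω e i j)]
    refine Finset.squarefree_prod_of_pairwise_isCoprime (fun p _ q _ hpq => ?_)
      fun p _ => (irreducible_diagConic hω he p.1 p.2).squarefree
    refine Irreducible.isRelPrime_of_not_associated (irreducible_diagConic hω he p.1 p.2)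
      (irreducible_diagConic hω he q.1 q.2) fun h => hpq ?_
    exact Prod.ext_iff.mpr (eq_of_associated_diagConic hω h)
  · refine Finset.squarefree_prod_of_pairwise_isCoprime (fun p _ q _ hpq => ?_)
      fun p _ => (hX p).squarefree
    refine Irreducible.isRelPrime_of_not_associated (hX p) (hX q) fun h => hpq ?_
    obtain ⟨u, hu⟩ := Associated.exists_C_mul h
    have := congrArg (eval (Pi.single q 1)) hu
    by_contra hne
    simp [hne] at this

/-! ### Equations of the nine conics in terms of the cubes of the variables -/

lemma C_two : (C 2 : S) = 2 := map_ofNat C 2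

lemma C_three : (C 3 : S) = 3 := map_ofNat C 3

lemma C_four : (C 4 : S) = 4 := map_ofNat C 4

lemma C_eight : (C 8 : S) = 8 := map_ofNat C 8

lemma C_ten : (C 10 : S) = 10 := map_ofNat C 10

lemma C_thirteen : (C 13 : S) = 13 := map_ofNat C 13

lemma C_twentySeven : (C 27 : S) = 27 := map_ofNat C 27

/-- The norm of `a + bt + ct²` under `t ↦ wt`. It is used twice, for the variable `z` and then for
`y`. -/
lemma prod_three_cubeRoots {R : Type*} [CommRing R] {w : R} (hw : w ^ 2 + w + 1 = 0)
    (a b c t : R) :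
    (a + b * t + c * t ^ 2) * (a + b * (w * t) + c * (w * t) ^ 2) *
      (a + b * (w ^ 2 * t) + c * (w ^ 2 * t) ^ 2) =
    a ^ 3 + b ^ 3 * t ^ 3 + c ^ 3 * (t ^ 3) ^ 2 - 3 * a * b * c * t ^ 3 := by
  grind

lemma diagConic_eq (i j : Fin 3) : diagConic ω e i j =
    (C e * (X 0 ^ 2 + (C ω ^ (i : ℕ) * X 1) ^ 2) + X 0 * (C ω ^ (i : ℕ) * X 1)) +
      (X 0 + C ω ^ (i : ℕ) * X 1) * (C ω ^ (j : ℕ) * X 2) + C e * (C ω ^ (j : ℕ) * X 2) ^ 2 := by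
  simp only [diagConic, quadric, C_mul, C_pow]
  ring

lemma prod_diagConic (hω : ω ^ 2 + ω + 1 = 0) (i : Fin 3) : ∏ j, diagConic ω e i j =
    (C e * (X 0 ^ 2 + (C ω ^ (i : ℕ) * X 1) ^ 2) + X 0 * (C ω ^ (i : ℕ) * X 1)) ^ 3 +
      (X 0 + C ω ^ (i : ℕ) * X 1) ^ 3 * X 2 ^ 3 + C e ^ 3 * (X 2 ^ 3) ^ 2 -
      3 * (C e * (X 0 ^ 2 + (C ω ^ (i : ℕ) * X 1) ^ 2) + X 0 * (C ω ^ (i : ℕ) * X 1)) *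
        (X 0 + C ω ^ (i : ℕ) * X 1) * C e * X 2 ^ 3 := by
  have hw : (C ω : S) ^ 2 + C ω + 1 = 0 := by
    rw [← C_pow, ← C_add, ← C_1, ← C_add, hω, C_0]
  rw [← prod_three_cubeRoots hw, Fin.prod_univ_three]
  simp [diagConic_eq]

lemma nineConics_one (hω : ω ^ 2 + ω + 1 = 0) : nineConics ω 1 =
    ((X 0 ^ 3 + X 1 ^ 3 + X 2 ^ 3) ^ 2 -
      C 4 * (X 0 ^ 3 * X 1 ^ 3 + X 0 ^ 3 * X 2 ^ 3 + X 1 ^ 3 * X 2 ^ 3)) ^ 3 +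
      C 27 * (X 0 ^ 3 * X 1 ^ 3 * X 2 ^ 3) ^ 2 := by
  have hw : (C ω : S) ^ 2 + C ω + 1 = 0 := by
    rw [← C_pow, ← C_add, ← C_1, ← C_add, hω, C_0]
  have h := prod_three_cubeRoots hw
    (X 0 ^ 6 + 7 * X 0 ^ 3 * X 1 ^ 3 + (X 1 ^ 3) ^ 2 - (2 * X 0 ^ 3 + 2 * X 1 ^ 3) * X 2 ^ 3 +
      (X 2 ^ 3) ^ 2)
    (3 * X 0 ^ 5 + 6 * X 0 ^ 2 * X 1 ^ 3 - 3 * X 0 ^ 2 * X 2 ^ 3)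
    (6 * X 0 ^ 4 + 3 * X 0 * X 1 ^ 3 - 3 * X 0 * X 2 ^ 3) (X 1)
  have hw3 : (C ω : S) ^ 3 = 1 := by linear_combination (C ω - 1) * hw
  -- With `s = ωⁱ y` and `s³ = y³`, the norm in `z` reduces to a quadratic polynomial in `s`, to
  -- which the norm formula applies again.
  have hstep : ∀ s : S, s ^ 3 = X 1 ^ 3 →
      ((C 1 * (X 0 ^ 2 + s ^ 2) + X 0 * s) ^ 3 + (X 0 + s) ^ 3 * X 2 ^ 3 +
        C 1 ^ 3 * (X 2 ^ 3) ^ 2 - 3 * (C 1 * (X 0 ^ 2 + s ^ 2) + X 0 * s) * (X 0 + s) * C 1 * X 2 ^ 3 : S) =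
      (X 0 ^ 6 + 7 * X 0 ^ 3 * X 1 ^ 3 + (X 1 ^ 3) ^ 2 - (2 * X 0 ^ 3 + 2 * X 1 ^ 3) * X 2 ^ 3 +
      (X 2 ^ 3) ^ 2) + (3 * X 0 ^ 5 + 6 * X 0 ^ 2 * X 1 ^ 3 - 3 * X 0 ^ 2 * X 2 ^ 3) * s +
      (6 * X 0 ^ 4 + 3 * X 0 * X 1 ^ 3 - 3 * X 0 * X 2 ^ 3) * s ^ 2 := fun s hs => by
    rw [C_1, ← hs]
    ring
  simp only [nineConics, prod_diagConic hω, Fin.prod_univ_three]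
  rw [hstep _ (by simp), hstep _ (by rw [mul_pow, Fin.val_one, pow_one, hw3, one_mul]),
    hstep _ (by rw [mul_pow, Fin.val_two, ← pow_mul, mul_comm 2 3, pow_mul, hw3]; simp)]
  simp only [Fin.val_zero, Fin.val_one, Fin.val_two, pow_zero, one_mul, pow_one]
  rw [h]
  simp only [C_four, C_twentySeven]
  ring

lemma nineConics_zero (hω : ω ^ 2 + ω + 1 = 0) : nineConics ω 0 =
    (X 0 ^ 3 * X 1 ^ 3 + X 0 ^ 3 * X 2 ^ 3 + X 1 ^ 3 * X 2 ^ 3) ^ 3 -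
      C 27 * (X 0 ^ 3 * X 1 ^ 3 * X 2 ^ 3) ^ 2 := by
  have hw : (C ω : S) ^ 2 + C ω + 1 = 0 := by
    rw [← C_pow, ← C_add, ← C_1, ← C_add, hω, C_0]
  have h := prod_three_cubeRoots hw
    (X 0 ^ 3 * X 1 ^ 3 + X 0 ^ 3 * X 2 ^ 3 + X 1 ^ 3 * X 2 ^ 3)
    (3 * X 0 ^ 2 * X 2 ^ 3) (3 * X 0 * X 2 ^ 3) (X 1)
  have hw3 : (C ω : S) ^ 3 = 1 := by linear_combination (C ω - 1) * hw
  have hstep : ∀ s : S, s ^ 3 = X 1 ^ 3 →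
      ((C 0 * (X 0 ^ 2 + s ^ 2) + X 0 * s) ^ 3 + (X 0 + s) ^ 3 * X 2 ^ 3 +
        C 0 ^ 3 * (X 2 ^ 3) ^ 2 - 3 * (C 0 * (X 0 ^ 2 + s ^ 2) + X 0 * s) * (X 0 + s) * C 0 * X 2 ^ 3 : S) =
      (X 0 ^ 3 * X 1 ^ 3 + X 0 ^ 3 * X 2 ^ 3 + X 1 ^ 3 * X 2 ^ 3) + (3 * X 0 ^ 2 * X 2 ^ 3) * s +
      (3 * X 0 * X 2 ^ 3) * s ^ 2 := fun s hs => by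
    rw [C_0, ← hs]
    ring
  simp only [nineConics, prod_diagConic hω, Fin.prod_univ_three]
  rw [hstep _ (by simp), hstep _ (by rw [mul_pow, Fin.val_one, pow_one, hw3, one_mul]),
    hstep _ (by rw [mul_pow, Fin.val_two, ← pow_mul, mul_comm 2 3, pow_mul, hw3]; simp)]
  simp only [Fin.val_zero, Fin.val_one, Fin.val_two, pow_zero, one_mul, pow_one]
  rw [h]
  rw [C_twentySeven]
  ring

end NineConics

/-! ### Bases of logarithmic vector fields for the normal forms -/

section Saito

variable {ω : ℂ}

lemma pderiv_X_table (i j : Fin 3) : pderiv i (X j : S) = if i = j then 1 else 0 := by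
  rw [pderiv_X, Pi.single_apply]
  simp only [eq_comm]

lemma isHomogeneous_cube (i : Fin 3) : ((X i : S) ^ 3).IsHomogeneous 3 := isHomogeneous_X_pow i 3

/-- A quartic in three cubes, symmetric in the last two of them. -/
def quarticField (p q r : S) : S :=
  p ^ 3 * (q + r) - p ^ 2 * (q + r) ^ 2 - C 10 * (p ^ 2 * (q * r)) - p * (q + r) ^ 3 +
    C 13 * (p * (q + r) * (q * r)) + ((q + r) ^ 2 - C 4 * (q * r)) * ((q + r) ^ 2 - C 8 * (q * r))

lemma isHomogeneous_quarticField {p q r : S} (hp : p.IsHomogeneous 3) (hq : q.IsHomogeneous 3)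
    (hr : r.IsHomogeneous 3) : (quarticField p q r).IsHomogeneous 12 := by
  have hs := hq.add hr
  have hm := hq.mul hr
  exact ((((((hp.pow 3).mul hs).sub ((hp.pow 2).mul (hs.pow 2))).sub
    (((hp.pow 2).mul hm).C_mul 10)).sub (hp.mul (hs.pow 3))).add
    (((hp.mul hs).mul hm).C_mul 13)).add (((hs.pow 2).sub (hm.C_mul 4)).mul
    ((hs.pow 2).sub (hm.C_mul 8)))

/-- A quadric in three cubes, symmetric in the last two of them. -/
def quadraticField (p q r : S) : S :=
  C 4 * p ^ 2 - C 3 * (p * (q + r)) - q * r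

lemma isHomogeneous_quadraticField {p q r : S} (hp : p.IsHomogeneous 3) (hq : q.IsHomogeneous 3)
    (hr : r.IsHomogeneous 3) : (quadraticField p q r).IsHomogeneous 6 :=
  (((hp.pow 2).C_mul 4).sub ((hp.mul (hq.add hr)).C_mul 3)).sub (hq.mul hr)

lemma isHomogeneous_diagConic (e : ℂ) (i j : Fin 3) : (diagConic ω e i j).IsHomogeneous 2 :=
  isHomogeneous_quadric ..

lemma isHomogeneous_nineConics (e : ℂ) : (nineConics ω e).IsHomogeneous 18 :=
  IsHomogeneous.prod Finset.univ _ (fun _ => 6) fun i _ =>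
    IsHomogeneous.prod Finset.univ _ (fun _ => 2) fun j _ => isHomogeneous_diagConic e i j

lemma isHomogeneous_lines : (∏ i, (X i : S)).IsHomogeneous 3 :=
  IsHomogeneous.prod Finset.univ _ (fun _ => 1) fun i _ => isHomogeneous_X ℂ i

lemma hasSaitoBasis_nineConics_one_mul_lines (hω : ω ^ 2 + ω + 1 = 0) :
    HasSaitoBasis (nineConics ω 1 * ∏ i, (X i : S)) 7 13 := by
  have h3 := isHomogeneous_cube
  have h1 := isHomogeneous_X (σ := Fin 3) ℂ
  have ha : ∀ i j k : Fin 3, ((X j ^ 3 - X k ^ 3) * (X i ^ 3 - X j ^ 3 - X k ^ 3) : S).IsHomogeneous 6 :=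
    fun i j k => ((h3 j).sub (h3 k)).mul (((h3 i).sub (h3 j)).sub (h3 k))
  have hb := fun i j k => isHomogeneous_quarticField (h3 i) (h3 j) (h3 k)
  refine ⟨(isHomogeneous_nineConics 1).mul isHomogeneous_lines,
    ![X 0 * ((X 1 ^ 3 - X 2 ^ 3) * (X 0 ^ 3 - X 1 ^ 3 - X 2 ^ 3)),
      X 1 * ((X 2 ^ 3 - X 0 ^ 3) * (X 1 ^ 3 - X 2 ^ 3 - X 0 ^ 3)),
      X 2 * ((X 0 ^ 3 - X 1 ^ 3) * (X 2 ^ 3 - X 0 ^ 3 - X 1 ^ 3))],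
    ![X 0 * quarticField (X 0 ^ 3) (X 1 ^ 3) (X 2 ^ 3),
      X 1 * quarticField (X 1 ^ 3) (X 2 ^ 3) (X 0 ^ 3),
      X 2 * quarticField (X 2 ^ 3) (X 0 ^ 3) (X 1 ^ 3)],
    -- Each cofactor is the sum of the quotients of the field's components by the variables, which
    -- is the contribution of `xyz` alone: both fields annihilate the product of the nine conics.
    (X 1 ^ 3 - X 2 ^ 3) * (X 0 ^ 3 - X 1 ^ 3 - X 2 ^ 3) +
      (X 2 ^ 3 - X 0 ^ 3) * (X 1 ^ 3 - X 2 ^ 3 - X 0 ^ 3) +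
      (X 0 ^ 3 - X 1 ^ 3) * (X 2 ^ 3 - X 0 ^ 3 - X 1 ^ 3),
    quarticField (X 0 ^ 3) (X 1 ^ 3) (X 2 ^ 3) + quarticField (X 1 ^ 3) (X 2 ^ 3) (X 0 ^ 3) +
      quarticField (X 2 ^ 3) (X 0 ^ 3) (X 1 ^ 3), 2, by norm_num, ?_, ?_,
    ((ha 0 1 2).add (ha 1 2 0)).add (ha 2 0 1), ((hb 0 1 2).add (hb 1 2 0)).add (hb 2 0 1),
    ?_, ?_, ?_⟩
  · intro i
    fin_cases i
    · exact (h1 0).mul (ha 0 1 2)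
    · exact (h1 1).mul (ha 1 2 0)
    · exact (h1 2).mul (ha 2 0 1)
  · intro i
    fin_cases i
    · exact (h1 0).mul (hb 0 1 2)
    · exact (h1 1).mul (hb 1 2 0)
    · exact (h1 2).mul (hb 2 0 1)
  · rw [nineConics_one hω, gradientMap_apply, Fin.prod_univ_three]
    simp only [Matrix.cons_val, map_add, map_sub, pderiv_mul, pderiv_pow, pderiv_C, pderiv_X_table,
      Fin.reduceEq, if_true, if_false]
    simp only [C_four, C_twentySeven]
    ring
  · rw [nineConics_one hω, gradientMap_apply, Fin.prod_univ_three]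
    simp only [Matrix.cons_val, map_add, map_sub, pderiv_mul, pderiv_pow, pderiv_C, pderiv_X_table,
      Fin.reduceEq, if_true, if_false]
    simp only [C_four, C_eight, C_ten,
      C_thirteen, C_twentySeven, quarticField]
    ring
  · rw [nineConics_one hω, Fin.prod_univ_three]
    simp only [Matrix.det_fin_three, Matrix.of_apply, Matrix.cons_val, C_two, C_four, C_eight, C_ten,
      C_thirteen, C_twentySeven, quarticField]
    ring

lemma hasSaitoBasis_nineConics_zero (hω : ω ^ 2 + ω + 1 = 0) :
    HasSaitoBasis (nineConics ω 0) 7 10 := by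
  have h3 := isHomogeneous_cube
  have h1 := isHomogeneous_X (σ := Fin 3) ℂ
  have ha : ∀ i j k : Fin 3, (X i ^ 3 * (X j ^ 3 - X k ^ 3) : S).IsHomogeneous 6 :=
    fun i j k => (h3 i).mul ((h3 j).sub (h3 k))
  have hb := fun i j k => ((h1 j).pow 2 |>.mul ((h1 k).pow 2)).mul
    (isHomogeneous_quadraticField (h3 i) (h3 j) (h3 k))
  refine ⟨isHomogeneous_nineConics 0,
    ![X 0 * (X 0 ^ 3 * (X 1 ^ 3 - X 2 ^ 3)), X 1 * (X 1 ^ 3 * (X 2 ^ 3 - X 0 ^ 3)),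
      X 2 * (X 2 ^ 3 * (X 0 ^ 3 - X 1 ^ 3))],
    ![X 1 ^ 2 * X 2 ^ 2 * quadraticField (X 0 ^ 3) (X 1 ^ 3) (X 2 ^ 3),
      X 2 ^ 2 * X 0 ^ 2 * quadraticField (X 1 ^ 3) (X 2 ^ 3) (X 0 ^ 3),
      X 0 ^ 2 * X 1 ^ 2 * quadraticField (X 2 ^ 3) (X 0 ^ 3) (X 1 ^ 3)],
    0, 0, 2, by norm_num, ?_, ?_, isHomogeneous_zero .., isHomogeneous_zero .., ?_, ?_, ?_⟩
  · intro i
    fin_cases i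
    · exact (h1 0).mul (ha 0 1 2)
    · exact (h1 1).mul (ha 1 2 0)
    · exact (h1 2).mul (ha 2 0 1)
  · intro i
    fin_cases i
    · exact hb 0 1 2
    · exact hb 1 2 0
    · exact hb 2 0 1
  · rw [nineConics_zero hω, gradientMap_apply]
    simp only [Matrix.cons_val, map_add, map_sub, pderiv_mul, pderiv_pow, pderiv_C, pderiv_X_table,
      Fin.reduceEq, if_true, if_false]
    simp only [C_twentySeven]
    ring
  · rw [nineConics_zero hω, gradientMap_apply]
    simp only [Matrix.cons_val, map_add, map_sub, pderiv_mul, pderiv_pow, pderiv_C, pderiv_X_table,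
      Fin.reduceEq, if_true, if_false]
    simp only [C_three, C_four, C_twentySeven, quadraticField]
    ring
  · rw [nineConics_zero hω]
    simp only [Matrix.det_fin_three, Matrix.of_apply, Matrix.cons_val, C_two, C_three, C_four,
      C_twentySeven, quadraticField]
    ring

/-- Adding the three coordinate lines multiplies the second field by `xyz`. -/
lemma hasSaitoBasis_nineConics_zero_mul_lines (hω : ω ^ 2 + ω + 1 = 0) :
    HasSaitoBasis (nineConics ω 0 * ∏ i, (X i : S)) 7 13 := by
  have h3 := isHomogeneous_cube
  have h1 := isHomogeneous_X (σ := Fin 3) ℂ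
  have ha : ∀ i j k : Fin 3, (X i ^ 3 * (X j ^ 3 - X k ^ 3) : S).IsHomogeneous 6 :=
    fun i j k => (h3 i).mul ((h3 j).sub (h3 k))
  have hc := fun i j k => ((h3 j).mul (h3 k)).mul
    (isHomogeneous_quadraticField (h3 i) (h3 j) (h3 k))
  refine ⟨(isHomogeneous_nineConics 0).mul isHomogeneous_lines,
    ![X 0 * (X 0 ^ 3 * (X 1 ^ 3 - X 2 ^ 3)), X 1 * (X 1 ^ 3 * (X 2 ^ 3 - X 0 ^ 3)),
      X 2 * (X 2 ^ 3 * (X 0 ^ 3 - X 1 ^ 3))],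
    ![X 0 * (X 1 ^ 3 * X 2 ^ 3 * quadraticField (X 0 ^ 3) (X 1 ^ 3) (X 2 ^ 3)),
      X 1 * (X 2 ^ 3 * X 0 ^ 3 * quadraticField (X 1 ^ 3) (X 2 ^ 3) (X 0 ^ 3)),
      X 2 * (X 0 ^ 3 * X 1 ^ 3 * quadraticField (X 2 ^ 3) (X 0 ^ 3) (X 1 ^ 3))],
    -- The first cofactor is `x³(y³ - z³) + y³(z³ - x³) + z³(x³ - y³) = 0`; the second again comes
    -- from `xyz` alone.
    0, X 1 ^ 3 * X 2 ^ 3 * quadraticField (X 0 ^ 3) (X 1 ^ 3) (X 2 ^ 3) +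
      X 2 ^ 3 * X 0 ^ 3 * quadraticField (X 1 ^ 3) (X 2 ^ 3) (X 0 ^ 3) +
      X 0 ^ 3 * X 1 ^ 3 * quadraticField (X 2 ^ 3) (X 0 ^ 3) (X 1 ^ 3), 2, by norm_num, ?_, ?_,
    isHomogeneous_zero .., ((hc 0 1 2).add (hc 1 2 0)).add (hc 2 0 1), ?_, ?_, ?_⟩
  · intro i
    fin_cases i
    · exact (h1 0).mul (ha 0 1 2)
    · exact (h1 1).mul (ha 1 2 0)
    · exact (h1 2).mul (ha 2 0 1)
  · intro i
    fin_cases i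
    · exact (h1 0).mul (hc 0 1 2)
    · exact (h1 1).mul (hc 1 2 0)
    · exact (h1 2).mul (hc 2 0 1)
  · rw [nineConics_zero hω, gradientMap_apply, Fin.prod_univ_three]
    simp only [Matrix.cons_val, map_add, map_sub, pderiv_mul, pderiv_pow, pderiv_C, pderiv_X_table,
      Fin.reduceEq, if_true, if_false]
    simp only [C_twentySeven]
    ring
  · rw [nineConics_zero hω, gradientMap_apply, Fin.prod_univ_three]
    simp only [Matrix.cons_val, map_add, map_sub, pderiv_mul, pderiv_pow, pderiv_C, pderiv_X_table,
      Fin.reduceEq, if_true, if_false]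
    simp only [C_three, C_four, C_twentySeven, quadraticField]
    ring
  · rw [nineConics_zero hω, Fin.prod_univ_three]
    simp only [Matrix.det_fin_three, Matrix.of_apply, Matrix.cons_val, C_two, C_three, C_four,
      C_twentySeven, quadraticField]
    ring

end Saito

/-! ### Normal forms of the special members of the Hesse family of conics -/

lemma C_mul_quadric (u a b c e g h : ℂ) : C u * quadric a b c e g h =
    quadric (u * a) (u * b) (u * c) (u * e) (u * g) (u * h) := by
  simp only [quadric, C_mul]
  ring

lemma linearSubst_quadric (M : Matrix (Fin 3) (Fin 3) ℂ) (a b c e g h : ℂ) :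
    linearSubst M (quadric a b c e g h) =
      quadric
        (a * M 0 0 ^ 2 + b * (M 0 0 * M 1 0) + c * (M 0 0 * M 2 0) + e * (M 1 0 * M 2 0) +
          g * M 1 0 ^ 2 + h * M 2 0 ^ 2)
        (2 * a * (M 0 0 * M 0 1) + b * (M 0 0 * M 1 1 + M 0 1 * M 1 0) +
          c * (M 0 0 * M 2 1 + M 0 1 * M 2 0) + e * (M 1 0 * M 2 1 + M 1 1 * M 2 0) +
          2 * g * (M 1 0 * M 1 1) + 2 * h * (M 2 0 * M 2 1))
        (2 * a * (M 0 0 * M 0 2) + b * (M 0 0 * M 1 2 + M 0 2 * M 1 0) +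
          c * (M 0 0 * M 2 2 + M 0 2 * M 2 0) + e * (M 1 0 * M 2 2 + M 1 2 * M 2 0) +
          2 * g * (M 1 0 * M 1 2) + 2 * h * (M 2 0 * M 2 2))
        (2 * a * (M 0 1 * M 0 2) + b * (M 0 1 * M 1 2 + M 0 2 * M 1 1) +
          c * (M 0 1 * M 2 2 + M 0 2 * M 2 1) + e * (M 1 1 * M 2 2 + M 1 2 * M 2 1) +
          2 * g * (M 1 1 * M 1 2) + 2 * h * (M 2 1 * M 2 2))
        (a * M 0 1 ^ 2 + b * (M 0 1 * M 1 1) + c * (M 0 1 * M 2 1) + e * (M 1 1 * M 2 1) +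
          g * M 1 1 ^ 2 + h * M 2 1 ^ 2)
        (a * M 0 2 ^ 2 + b * (M 0 2 * M 1 2) + c * (M 0 2 * M 2 2) + e * (M 1 2 * M 2 2) +
          g * M 1 2 ^ 2 + h * M 2 2 ^ 2) := by
  simp only [quadric, map_add, map_mul, map_pow, linearSubst_C, linearSubst_X, Fin.sum_univ_three,
    C_two]
  ring

/-- `p² - pq + q²` is the norm `(p + qω)(p + qω²)`. -/
lemma add_mul_cubeRoot_ne_zero {ω : ℂ} (hω : ω ^ 2 + ω + 1 = 0) {p q : ℂ}
    (h : p ^ 2 - p * q + q ^ 2 ≠ 0) : p + q * ω ≠ 0 := fun h0 =>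
  h (by linear_combination (p - q - q * ω) * h0 + q ^ 2 * hω)

/-- The factor of the discriminant of `conic ω t j` which depends on `t`. -/
def degeneracy (ω t : ℂ) : Fin 12 → ℂ :=
  let c : ℂ → ℂ := fun s => (s - 1) * (s + 2)
  ![c t, c t, t, c (ω * t), c (ω ^ 2 * t), c (ω ^ 2 * t), t, c (ω * t), c (ω * t),
    c (ω ^ 2 * t), t, c t]

lemma ne_zero_iff_of_eq_mul {D u s : ℂ} (hu : u ≠ 0) (hD : D = u * s) : D ≠ 0 ↔ s ≠ 0 := by
  rw [hD]
  simp [hu]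

lemma ne_zero_iff_of_eq_mul_sq_mul {D u s : ℂ} (hu : u ≠ 0)
    (hD : D = u * ((s - 1) ^ 2 * (s + 2))) : D ≠ 0 ↔ (s - 1) * (s + 2) ≠ 0 := by
  rw [hD]
  simp [hu]

/-- For nine of the conics the discriminant is a nonzero constant times `(s - 1)²(s + 2)`, where `s`
is `t`, `ωt` or `ω²t`; for the other three it is a nonzero constant times `t`. -/
lemma isSmoothCurve_conic_iff {ω : ℂ} (hω : ω ^ 2 + ω + 1 = 0) (t : ℂ) (j : Fin 12) :
    IsSmoothCurve (conic ω t j) ↔ degeneracy ω t j ≠ 0 := by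
  have h0 := ne_zero_of_cubeRoot hω
  have h2 : (2 : ℂ) ≠ 0 := two_ne_zero
  have hu1 : 2 * ω ≠ 0 := mul_ne_zero h2 h0
  have hu2 : 2 * ω ^ 2 ≠ 0 := mul_ne_zero h2 (pow_ne_zero 2 h0)
  fin_cases j <;> refine (isSmoothCurve_quadric_iff ..).trans ?_
  · exact ne_zero_iff_of_eq_mul_sq_mul h2 (by simp only [quadricDisc]; grind)
  · exact ne_zero_iff_of_eq_mul_sq_mul h2 (by simp only [quadricDisc]; grind)
  · exact ne_zero_iff_of_eq_mul (s := t) h2 (by simp only [quadricDisc]; ring)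
  · exact ne_zero_iff_of_eq_mul_sq_mul hu2 (by simp only [quadricDisc]; grind)
  · exact ne_zero_iff_of_eq_mul_sq_mul hu1 (by simp only [quadricDisc]; grind)
  · exact ne_zero_iff_of_eq_mul_sq_mul hu1 (by simp only [quadricDisc]; grind)
  · exact ne_zero_iff_of_eq_mul (s := t) h2 (by simp only [quadricDisc]; ring)
  · exact ne_zero_iff_of_eq_mul_sq_mul hu2 (by simp only [quadricDisc]; grind)
  · exact ne_zero_iff_of_eq_mul_sq_mul hu2 (by simp only [quadricDisc]; grind)
  · exact ne_zero_iff_of_eq_mul_sq_mul hu1 (by simp only [quadricDisc]; grind)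
  · exact ne_zero_iff_of_eq_mul (s := t) (neg_ne_zero.mpr h2) (by simp only [quadricDisc]; ring)
  · exact ne_zero_iff_of_eq_mul_sq_mul h2 (by simp only [quadricDisc]; grind)

lemma mem_smoothIndices_iff {ω : ℂ} (hω : ω ^ 2 + ω + 1 = 0) (t : ℂ) (j : Fin 12) :
    j ∈ smoothIndices ω t ↔ degeneracy ω t j ≠ 0 := by
  simp only [smoothIndices, Finset.mem_filter_univ, isSmoothCurve_conic_iff hω]

/-- In suitable coordinates, the smooth conics among `conic ω t j` are the `diagConic ω e p q`,
and the product of the other ones is `(xyz)²` up to a constant. -/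
def HasNormalForm (ω t e : ℂ) : Prop :=
  ∃ (M N : Matrix (Fin 3) (Fin 3) ℂ) (φ : Fin 3 × Fin 3 ↪ Fin 12), M * N = 1 ∧ N * M = 1 ∧
    smoothIndices ω t = Finset.univ.map φ ∧
    (∀ p, ∃ u : ℂ, u ≠ 0 ∧ conic ω t (φ p) = C u * linearSubst M (diagConic ω e p.1 p.2)) ∧
    ∃ u : ℂ, u ≠ 0 ∧
      ∏ j ∈ (Finset.univ.map φ)ᶜ, conic ω t j = C u * linearSubst M (∏ i, X i) ^ 2

/-! ### The symmetry `z ↦ ωz` of the family -/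

/-- The permutation of the twelve conics induced by `z ↦ ωz`, `t ↦ ωt`. -/
def rotateIndex : Equiv.Perm (Fin 12) where
  toFun := ![7, 8, 2, 4, 11, 1, 6, 9, 5, 0, 10, 3]
  invFun := ![9, 5, 2, 11, 3, 8, 6, 0, 1, 7, 10, 4]
  left_inv := by intro j; fin_cases j <;> rfl
  right_inv := by intro j; fin_cases j <;> rfl

lemma degeneracy_rotateIndex {ω : ℂ} (hω : ω ^ 2 + ω + 1 = 0) (t : ℂ) (j : Fin 12) :
    degeneracy ω t (rotateIndex j) ≠ 0 ↔ degeneracy ω (ω * t) j ≠ 0 := by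
  have h0 := ne_zero_of_cubeRoot hω
  have key : degeneracy ω (ω * t) j =
      ![1, 1, ω, 1, 1, 1, ω, 1, 1, 1, ω, 1] j * degeneracy ω t (rotateIndex j) := by
    fin_cases j <;> simp [degeneracy, rotateIndex] <;> grind
  refine (ne_zero_iff_of_eq_mul ?_ key).symm
  fin_cases j <;> simp [h0]

lemma linearSubst_conic_rotate {ω : ℂ} (hω : ω ^ 2 + ω + 1 = 0) (t : ℂ) (j : Fin 12) :
    ∃ u : ℂ, u ≠ 0 ∧ linearSubst (Matrix.diagonal ![1, 1, ω]) (conic ω (ω * t) j) =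
      C u * conic ω t (rotateIndex j) := by
  have h0 := ne_zero_of_cubeRoot hω
  refine ⟨![1, 1, 1, 1, 1, 1, ω, 1, 1, 1, ω, 1] j, ?_, ?_⟩
  · fin_cases j <;> simp [h0]
  · fin_cases j <;>
    · simp only [conic, rotateIndex, Equiv.coe_fn_mk, Matrix.cons_val, Fin.reduceFinMk,
        Fin.zero_eta, Fin.mk_one]
      rw [linearSubst_quadric, C_mul_quadric]
      congr 1 <;> simp [Matrix.diagonal] <;> grind

/-- Composing the coordinate change at `ωt` with `diag(1, 1, ω)` gives one at `t`; the indices move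
by `rotateIndex`, and scalars are absorbed into the constants. -/
lemma HasNormalForm.rotate {ω t e : ℂ} (hω : ω ^ 2 + ω + 1 = 0) (H : HasNormalForm ω (ω * t) e) :
    HasNormalForm ω t e := by
  obtain ⟨M, N, φ, hMN, hNM, hs, hc, v, hv, hd⟩ := H
  have h0 := ne_zero_of_cubeRoot hω
  set D : Matrix (Fin 3) (Fin 3) ℂ := Matrix.diagonal ![1, 1, ω]
  set D' : Matrix (Fin 3) (Fin 3) ℂ := Matrix.diagonal ![1, 1, ω⁻¹]
  have hDD' : D * D' = 1 := by
    rw [Matrix.diagonal_mul_diagonal, ← Matrix.diagonal_one]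
    congr 1
    funext i
    fin_cases i <;> simp [h0]
  have hD'D : D' * D = 1 := by
    rw [Matrix.diagonal_mul_diagonal, ← Matrix.diagonal_one]
    congr 1
    funext i
    fin_cases i <;> simp [h0]
  choose u hu hconic using fun j => linearSubst_conic_rotate hω t j
  have hconic' : ∀ j, conic ω t (rotateIndex j) = C (u j)⁻¹ * linearSubst D (conic ω (ω * t) j) :=
    fun j => by rw [hconic, ← mul_assoc, ← C_mul, inv_mul_cancel₀ (hu j), C_1, one_mul]
  have hmap : ∀ s : Finset (Fin 12), ∀ j, rotateIndex j ∈ s.map rotateIndex.toEmbedding ↔ j ∈ s :=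
    fun s j => by simp
  refine ⟨M * D, D' * N, φ.trans rotateIndex.toEmbedding, ?_, ?_, ?_, fun p => ?_, ?_⟩
  · rw [Matrix.mul_assoc, ← Matrix.mul_assoc D, hDD', Matrix.one_mul, hMN]
  · rw [Matrix.mul_assoc, ← Matrix.mul_assoc N, hNM, Matrix.one_mul, hD'D]
  · rw [← Finset.map_map, ← hs]
    ext j
    obtain ⟨i, rfl⟩ := rotateIndex.surjective j
    rw [hmap, mem_smoothIndices_iff hω, mem_smoothIndices_iff hω, degeneracy_rotateIndex hω]
  · obtain ⟨w, hw, hp⟩ := hc p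
    refine ⟨(u (φ p))⁻¹ * w, mul_ne_zero (inv_ne_zero (hu _)) hw, ?_⟩
    rw [Function.Embedding.trans_apply, Equiv.coe_toEmbedding, hconic', hp, map_mul, linearSubst_C,
      linearSubst_linearSubst, C_mul, mul_assoc]
  · refine ⟨(∏ j ∈ (Finset.univ.map φ)ᶜ, (u j)⁻¹) * v,
      mul_ne_zero (Finset.prod_ne_zero_iff.mpr fun j _ => inv_ne_zero (hu j)) hv, ?_⟩
    have hcompl : (Finset.univ.map (φ.trans rotateIndex.toEmbedding))ᶜ =
        ((Finset.univ.map φ)ᶜ).map rotateIndex.toEmbedding := by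
      ext j
      obtain ⟨i, rfl⟩ := rotateIndex.surjective j
      rw [hmap, Finset.mem_compl, Finset.mem_compl, ← Finset.map_map, hmap]
    rw [hcompl, Finset.prod_map]
    simp only [Equiv.coe_toEmbedding, hconic']
    rw [Finset.prod_mul_distrib, ← map_prod, ← map_prod, hd, map_mul, linearSubst_C, map_pow,
      linearSubst_linearSubst, C_mul, mul_assoc]

/-! ### Normal forms at `t = 0`, `t = 1` and `t = -2` -/

/-- The indices of the conics which are smooth for `t = 0`, in the order of `diagConic`. -/
def triangleIndex : Fin 3 × Fin 3 ↪ Fin 12 where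
  toFun p := ![![11, 3, 4], ![7, 9, 0], ![5, 1, 8]] p.1 p.2
  inj' := by decide

/-- The indices of the conics which are smooth for `t = 1` and for `t = -2`, in the order of
`diagConic`. -/
def fourierIndex : Fin 3 × Fin 3 ↪ Fin 12 where
  toFun p := ![![10, 4, 7], ![5, 8, 2], ![3, 6, 9]] p.1 p.2
  inj' := by decide

lemma hasNormalForm_zero {ω : ℂ} (hω : ω ^ 2 + ω + 1 = 0) : HasNormalForm ω 0 1 := by
  refine ⟨1, 1, triangleIndex, by simp, by simp, ?_, ?_, -1, by simp, ?_⟩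
  · ext j
    rw [mem_smoothIndices_iff hω,
      show Finset.univ.map triangleIndex = ({2, 6, 10} : Finset (Fin 12))ᶜ by decide]
    fin_cases j <;> simp [degeneracy]
  · rintro ⟨i, j⟩
    refine ⟨1, one_ne_zero, ?_⟩
    rw [linearSubst_one, diagConic, C_mul_quadric]
    fin_cases i <;> fin_cases j <;>
    · simp only [conic, triangleIndex, Function.Embedding.coeFn_mk, Matrix.cons_val, Fin.zero_eta,
        Fin.mk_one, Fin.reduceFinMk]
      congr 1 <;> simp <;> grind
  · rw [show (Finset.univ.map triangleIndex)ᶜ = ({2, 6, 10} : Finset (Fin 12)) by decide, linearSubst_one,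
      Fin.prod_univ_three]
    simp [conic, quadric]
    ring

/-- The matrix of the discrete Fourier transform. -/
def fourierMatrix (ω : ℂ) : Matrix (Fin 3) (Fin 3) ℂ :=
  !![1, 1, 1; 1, ω, ω ^ 2; 1, ω ^ 2, ω]

/-- The inverse of `fourierMatrix ω`. -/
def fourierMatrixInv (ω : ℂ) : Matrix (Fin 3) (Fin 3) ℂ :=
  !![1 / 3, 1 / 3, 1 / 3; 1 / 3, ω ^ 2 / 3, ω / 3; 1 / 3, ω / 3, ω ^ 2 / 3]

lemma fourierMatrix_mul_inv {ω : ℂ} (hω : ω ^ 2 + ω + 1 = 0) :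
    fourierMatrix ω * fourierMatrixInv ω = 1 := by
  ext i j
  fin_cases i <;> fin_cases j <;>
    simp [fourierMatrix, fourierMatrixInv, Matrix.mul_apply, Fin.sum_univ_three] <;> grind

/-- At both values the singular conics are `f₁`, `f₂`, `f₁₂`, and their lines are the rows of the
Fourier matrix. The factor 3 in `hconic` clears denominators, so that the constants `u` can be taken
in `ℤ[ω]`. -/
lemma hasNormalForm_fourier {ω : ℂ} (hω : ω ^ 2 + ω + 1 = 0) {t e : ℂ} {u : Fin 3 → Fin 3 → ℂ}
    (ht : t = 1 ∨ t = -2) (hu : ∀ i j, u i j ≠ 0)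
    (hconic : ∀ i j, C 3 * conic ω t (fourierIndex (i, j)) =
      C (u i j) * linearSubst (fourierMatrix ω) (diagConic ω e i j))
    (hprod : conic ω t 0 * conic ω t 1 * conic ω t 11 =
      linearSubst (fourierMatrix ω) (∏ i, X i) ^ 2) : HasNormalForm ω t e := by
  have hFF := fourierMatrix_mul_inv hω
  have h3 : (3 : ℂ) ≠ 0 := by norm_num
  refine ⟨fourierMatrix ω, fourierMatrixInv ω, fourierIndex, hFF, mul_eq_one_comm.mp hFF, ?_, ?_,
    1, one_ne_zero, ?_⟩
  · have h0 := ne_zero_of_cubeRoot hω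
    have h1 := ne_one_of_cubeRoot hω
    ext j
    rw [mem_smoothIndices_iff hω,
      show Finset.univ.map fourierIndex = ({0, 1, 11} : Finset (Fin 12))ᶜ by decide]
    have ht0 : t ≠ 0 := by rcases ht with rfl | rfl <;> norm_num
    have ht1 : (t - 1) * (t + 2) = 0 := by rcases ht with rfl | rfl <;> norm_num
    have ht2 : (ω * t - 1) * (ω * t + 2) ≠ 0 := by rcases ht with rfl | rfl <;> grind
    have ht3 : (ω ^ 2 * t - 1) * (ω ^ 2 * t + 2) ≠ 0 := by rcases ht with rfl | rfl <;> grind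
    fin_cases j
    · exact iff_of_false (not_not.mpr ht1) (by decide)
    · exact iff_of_false (not_not.mpr ht1) (by decide)
    · exact iff_of_true ht0 (by decide)
    · exact iff_of_true ht2 (by decide)
    · exact iff_of_true ht3 (by decide)
    · exact iff_of_true ht3 (by decide)
    · exact iff_of_true ht0 (by decide)
    · exact iff_of_true ht2 (by decide)
    · exact iff_of_true ht2 (by decide)
    · exact iff_of_true ht3 (by decide)
    · exact iff_of_true ht0 (by decide)
    · exact iff_of_false (not_not.mpr ht1) (by decide)
  · rintro ⟨i, j⟩
    refine ⟨3⁻¹ * u i j, mul_ne_zero (inv_ne_zero h3) (hu i j), ?_⟩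
    rw [C_mul, mul_assoc, ← hconic, ← mul_assoc, ← C_mul, inv_mul_cancel₀ h3, C_1, one_mul]
  · rw [show (Finset.univ.map fourierIndex)ᶜ = ({0, 1, 11} : Finset (Fin 12)) by decide, C_1,
      one_mul, ← hprod]
    simp [mul_assoc]

lemma hasNormalForm_one {ω : ℂ} (hω : ω ^ 2 + ω + 1 = 0) : HasNormalForm ω 1 0 := by
  refine hasNormalForm_fourier hω (.inl rfl)
    -- The two tables hold the integers `p`, `q` of the constants `p + qω`; these are nonzero
    -- because their norms are.
    (u := fun i j => ![![1, -1, 1], ![-1, -2, -1], ![1, -1, -1]] i j +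
      ![![0, -2, 2], ![-2, -1, 0], ![2, 0, 1]] i j * ω) ?_ ?_ ?_
  · intro i j
    refine add_mul_cubeRoot_ne_zero hω ?_
    fin_cases i <;> fin_cases j <;> simp <;> norm_num
  · intro i j
    rw [diagConic, linearSubst_quadric, C_mul_quadric]
    fin_cases i <;> fin_cases j <;>
    · simp only [conic, fourierIndex, Function.Embedding.coeFn_mk, Matrix.cons_val, Fin.zero_eta,
        Fin.mk_one, Fin.reduceFinMk]
      rw [C_mul_quadric]
      congr 1 <;> simp [fourierMatrix] <;> grind
  -- At `t = 1` the singular conics are double lines, pulled back from `y²`, `z²`, `x²`.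
  · have h0 : conic ω 1 0 = linearSubst (fourierMatrix ω) (quadric 0 0 0 0 1 0) := by
      simp only [conic, linearSubst_quadric, Matrix.cons_val]
      congr 1 <;> simp [fourierMatrix] <;> grind
    have h1 : conic ω 1 1 = linearSubst (fourierMatrix ω) (quadric 0 0 0 0 0 1) := by
      simp only [conic, linearSubst_quadric, Matrix.cons_val]
      congr 1 <;> simp [fourierMatrix] <;> grind
    have h2 : conic ω 1 11 = linearSubst (fourierMatrix ω) (quadric 1 0 0 0 0 0) := by
      simp only [conic, linearSubst_quadric, Matrix.cons_val]
      congr 1 <;> simp [fourierMatrix] <;> grind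
    rw [h0, h1, h2, ← map_mul, ← map_mul, ← map_pow]
    congr 1
    simp only [quadric, Fin.prod_univ_three, C_0, C_1]
    ring

lemma hasNormalForm_neg_two {ω : ℂ} (hω : ω ^ 2 + ω + 1 = 0) : HasNormalForm ω (-2) 1 := by
  refine hasNormalForm_fourier hω (.inr rfl)
    (u := fun i j => ![![-1, 1, 2], ![1, -1, 1], ![2, 1, -2]] i j +
      ![![0, -1, 1], ![-1, 1, 0], ![1, 0, -1]] i j * ω) ?_ ?_ ?_
  · intro i j
    refine add_mul_cubeRoot_ne_zero hω ?_
    fin_cases i <;> fin_cases j <;> simp <;> norm_num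
  · intro i j
    rw [diagConic, linearSubst_quadric, C_mul_quadric]
    fin_cases i <;> fin_cases j <;>
    · simp only [conic, fourierIndex, Function.Embedding.coeFn_mk, Matrix.cons_val, Fin.zero_eta,
        Fin.mk_one, Fin.reduceFinMk]
      rw [C_mul_quadric]
      congr 1 <;> simp [fourierMatrix] <;> grind
  -- At `t = -2` they are pairs of sides of a triangle, pulled back from `xz`, `xy`, `yz`.
  · have h0 : conic ω (-2) 0 = linearSubst (fourierMatrix ω) (quadric 0 0 1 0 0 0) := by
      simp only [conic, linearSubst_quadric, Matrix.cons_val]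
      congr 1 <;> simp [fourierMatrix] <;> grind
    have h1 : conic ω (-2) 1 = linearSubst (fourierMatrix ω) (quadric 0 1 0 0 0 0) := by
      simp only [conic, linearSubst_quadric, Matrix.cons_val]
      congr 1 <;> simp [fourierMatrix] <;> grind
    have h2 : conic ω (-2) 11 = linearSubst (fourierMatrix ω) (quadric 0 0 0 1 0 0) := by
      simp only [conic, linearSubst_quadric, Matrix.cons_val]
      congr 1 <;> simp [fourierMatrix] <;> grind
    rw [h0, h1, h2, ← map_mul, ← map_mul, ← map_pow]
    congr 1
    simp only [quadric, Fin.prod_univ_three, C_0, C_1]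
    ring

/-! ### Freeness of the arrangements -/

lemma squarefree_C_mul {u : ℂ} (hu : u ≠ 0) {f : S} (hf : Squarefree f) : Squarefree (C u * f) :=
  hf.squarefree_of_dvd ⟨C u⁻¹, by
    rw [mul_right_comm, ← C_mul, mul_inv_cancel₀ hu, C_1, one_mul]⟩

lemma isHomogeneous_conic (ω t : ℂ) (j : Fin 12) : (conic ω t j).IsHomogeneous 2 := by
  fin_cases j <;> exact isHomogeneous_quadric ..

lemma irreducible_conic {ω t : ℂ} {j : Fin 12} (hj : j ∈ smoothIndices ω t) :
    Irreducible (conic ω t j) :=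
  IsSmoothCurve.irreducible (isHomogeneous_conic ω t j) (by
    simpa only [smoothIndices, Finset.mem_filter_univ] using hj)

/-- The numerical and geometric content of a normal form. -/
lemma HasNormalForm.exists_equations {ω t e : ℂ} (H : HasNormalForm ω t e) :
    ∃ (M N : Matrix (Fin 3) (Fin 3) ℂ) (u v : ℂ), M * N = 1 ∧ N * M = 1 ∧ u ≠ 0 ∧ v ≠ 0 ∧
      (smoothIndices ω t).card = 9 ∧ arrB ω t = C u * linearSubst M (nineConics ω e) ∧
      hesseProduct ω t = C v * arrB ω t * linearSubst M (∏ i, X i) ^ 2 := by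
  obtain ⟨M, N, φ, hMN, hNM, hs, hc, v, hv, hd⟩ := H
  choose u hu hp using hc
  refine ⟨M, N, ∏ p, u p, v, hMN, hNM, Finset.prod_ne_zero_iff.mpr fun p _ => hu p, hv, ?_, ?_, ?_⟩
  · simp [hs]
  · rw [arrB, hs, Finset.prod_map, nineConics,
      ← Fintype.prod_prod_type' (f := fun i j => diagConic ω e i j), map_prod, map_prod,
      ← Finset.prod_mul_distrib]
    exact Finset.prod_congr rfl fun p _ => hp p
  · rw [hesseProduct, ← Finset.prod_mul_prod_compl (Finset.univ.map φ), hd, arrB, hs]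
    ring

lemma squarefree_linearSubst_nineConics_mul_lines {ω e : ℂ} (hω : ω ^ 2 + ω + 1 = 0)
    (he : 8 * e ^ 3 - 6 * e + 2 ≠ 0) {M N : Matrix (Fin 3) (Fin 3) ℂ} (hMN : M * N = 1)
    (hNM : N * M = 1) :
    Squarefree (linearSubst M (nineConics ω e) * linearSubst M (∏ i, X i)) := by
  rw [← map_mul]
  exact squarefree_linearSubst hMN hNM (squarefree_nineConics_mul_lines hω he)

lemma HasNormalForm.exists_lines {ω t e : ℂ} (hω : ω ^ 2 + ω + 1 = 0)
    (he : 8 * e ^ 3 - 6 * e + 2 ≠ 0) (H : HasNormalForm ω t e) :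
    ∃ ℓ : Fin 3 → S, IsNineConicsThreeDoubleLines ω t ℓ := by
  obtain ⟨M, N, u, v, hMN, hNM, hu, hv, hcard, hB, hprod⟩ := H.exists_equations
  have hsq := squarefree_linearSubst_nineConics_mul_lines hω he hMN hNM
  have hsqB : Squarefree (arrB ω t) := hB ▸ squarefree_C_mul hu hsq.of_mul_left
  have hirr : ∀ i, Irreducible (linearSubst M (X i)) := fun i =>
    (MulEquiv.irreducible_iff (linearSubstEquiv M N hMN hNM)).mpr
      (X_prime (R := ℂ) (i := i)).irreducible
  refine ⟨fun i => linearSubst M (X i), hcard, ?_, fun i => ?_, fun i => (hirr i).ne_zero, ?_,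
    v, hv, ?_⟩
  · intro i hi j hj hij h
    -- Two associated members would put the square of an irreducible polynomial into a squarefree
    -- product; the same argument separates the lines.
    refine (irreducible_conic hi).not_isUnit (hsqB _ ((mul_dvd_mul_left _ h.dvd).trans ?_))
    rw [arrB, ← Finset.mul_prod_erase _ _ hi]
    exact mul_dvd_mul_left _ (Finset.dvd_prod_of_mem _ (Finset.mem_erase.mpr ⟨hij.symm, hj⟩))
  · exact isHomogeneous_linearSubst M (isHomogeneous_X ℂ i)
  · intro i j hij h
    refine (hirr i).not_isUnit (hsq.of_mul_right _ ((mul_dvd_mul_left _ h.dvd).trans ?_))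
    rw [map_prod, ← Finset.mul_prod_erase _ _ (Finset.mem_univ i)]
    exact mul_dvd_mul_left _
      (Finset.dvd_prod_of_mem _ (Finset.mem_erase.mpr ⟨hij.symm, Finset.mem_univ j⟩))
  · rw [hprod, map_prod, Finset.prod_pow]

/-- Needed because the lines `ℓ` are arbitrary in the freeness statement: the factorization fixes
the square of their product up to a constant, hence the product itself up to a constant. -/
lemma exists_eq_C_mul_of_sq {b p q : S} {c v : ℂ} (hb : b ≠ 0) (hc : c ≠ 0) (hv : v ≠ 0)
    (h : C c * b * p ^ 2 = C v * b * q ^ 2) : ∃ s : ℂ, s ≠ 0 ∧ p = C s * q := by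
  have hcc : (C c⁻¹ : S) * C c = 1 := by rw [← C_mul, inv_mul_cancel₀ hc, C_1]
  obtain ⟨s, hs⟩ := IsAlgClosed.exists_pow_nat_eq (c⁻¹ * v) two_pos
  have hs0 : s ≠ 0 := by
    rintro rfl
    exact mul_ne_zero (inv_ne_zero hc) hv (by rw [← hs]; simp)
  have hsq : p ^ 2 = (C s * q) ^ 2 := by
    refine mul_left_cancel₀ hb ?_
    rw [mul_pow, ← C_pow, hs, C_mul]
    linear_combination C c⁻¹ * h - b * p ^ 2 * hcc
  rcases sq_eq_sq_iff_eq_or_eq_neg.mp hsq with h | h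
  · exact ⟨s, hs0, h⟩
  · exact ⟨-s, neg_ne_zero.mpr hs0, by rw [h, C_neg, neg_mul]⟩

lemma HasNormalForm.isFreeCurve_arrA {ω t e : ℂ} (hω : ω ^ 2 + ω + 1 = 0)
    (he : 8 * e ^ 3 - 6 * e + 2 ≠ 0) (H : HasNormalForm ω t e)
    (hS : HasSaitoBasis (nineConics ω e * ∏ i, (X i : S)) 7 13) {ℓ : Fin 3 → S}
    (hℓ : IsNineConicsThreeDoubleLines ω t ℓ) : IsFreeCurve (arrA ω t ℓ) 7 13 := by
  obtain ⟨M, N, u, v, hMN, hNM, hu, hv, hcard, hB, hprod⟩ := H.exists_equations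
  have hsq := squarefree_linearSubst_nineConics_mul_lines hω he hMN hNM
  have hB0 : arrB ω t ≠ 0 := by
    rw [hB]
    exact (squarefree_C_mul hu hsq.of_mul_left).ne_zero
  obtain ⟨c, hc, hfac⟩ := hℓ.factorization
  rw [Finset.prod_pow] at hfac
  obtain ⟨s', hs', hlin⟩ := exists_eq_C_mul_of_sq hB0 hc hv (hfac.symm.trans hprod)
  have hA : arrA ω t ℓ = C (u * s') * linearSubst M (nineConics ω e * ∏ i, X i) := by
    rw [arrA, hB, hlin, C_mul, map_mul]
    ring
  have hus := mul_ne_zero hu hs'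
  have hsqA : Squarefree (arrA ω t ℓ) := by
    rw [hA, map_mul (linearSubst M)]
    exact squarefree_C_mul hus hsq
  have hSA : HasSaitoBasis (arrA ω t ℓ) 7 13 := by
    rw [hA]
    exact (hS.linearSubst hMN hNM).C_mul hus
  exact isFreeCurve_of_hasSaitoBasis (by norm_num) (by norm_num) hsqA hSA

lemma HasNormalForm.isFreeCurve_arrB {ω t : ℂ} (hω : ω ^ 2 + ω + 1 = 0)
    (H : HasNormalForm ω t 0) : IsFreeCurve (arrB ω t) 7 10 := by
  obtain ⟨M, N, u, v, hMN, hNM, hu, hv, hcard, hB, hprod⟩ := H.exists_equations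
  have hsq := squarefree_linearSubst_nineConics_mul_lines (e := 0) hω (by norm_num) hMN hNM
  rw [hB]
  exact isFreeCurve_of_hasSaitoBasis (by norm_num) (by norm_num)
    (squarefree_C_mul hu hsq.of_mul_left)
    (((hasSaitoBasis_nineConics_zero hω).linearSubst hMN hNM).C_mul hu)

/-- `HasNormalForm.rotate` passes from `ωt` to `t`, that is, it divides by `ω`. As `ω³ = 1`, one
application reaches `tω²` and a second one `tω`. -/
lemma HasNormalForm.mul_cubeRoot {ω t e : ℂ} (hω : ω ^ 2 + ω + 1 = 0) (H : HasNormalForm ω t e) :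
    HasNormalForm ω (t * ω) e ∧ HasNormalForm ω (t * ω ^ 2) e := by
  have h2 : HasNormalForm ω (t * ω ^ 2) e := HasNormalForm.rotate hω (by
    rwa [show ω * (t * ω ^ 2) = t by linear_combination t * (ω - 1) * hω])
  exact ⟨HasNormalForm.rotate hω (by rwa [show ω * (t * ω) = t * ω ^ 2 by ring]), h2⟩

end HesseConics

end

theorem theorem6p1 (ω : ℂ) (hω : ω ^ 2 + ω + 1 = 0) :
    (∀ t ∈ ({-2, -2 * ω, -2 * ω ^ 2, 0, 1, ω, ω ^ 2} : Set ℂ),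
      (∃ ℓ : Fin 3 → HesseConics.S, HesseConics.IsNineConicsThreeDoubleLines ω t ℓ) ∧
      ∀ ℓ : Fin 3 → HesseConics.S, HesseConics.IsNineConicsThreeDoubleLines ω t ℓ →
        HesseConics.IsFreeCurve (HesseConics.arrA ω t ℓ) 7 13) ∧
    (∀ t ∈ ({1, ω, ω ^ 2} : Set ℂ),
      HesseConics.IsFreeCurve (HesseConics.arrB ω t) 7 10) := by
  have h1 := HesseConics.hasNormalForm_one hω
  have h1' := h1.mul_cubeRoot hω
  rw [one_mul, one_mul] at h1'
  have h2 := HesseConics.hasNormalForm_neg_two hω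
  have h2' := h2.mul_cubeRoot hω
  have h0 := HesseConics.hasNormalForm_zero hω
  -- In the case `e = 1` the singular conics are pairs of sides of the triangle; in the case `e = 0`
  -- they are squares of its sides.
  have triangle : ∀ {t : ℂ}, HesseConics.HasNormalForm ω t 1 → _ := fun {t} H =>
    And.intro (H.exists_lines hω (by norm_num)) fun ℓ hℓ =>
      H.isFreeCurve_arrA hω (by norm_num)
        (HesseConics.hasSaitoBasis_nineConics_one_mul_lines hω) (ℓ := ℓ) hℓ
  have square : ∀ {t : ℂ}, HesseConics.HasNormalForm ω t 0 → _ := fun {t} H =>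
    And.intro (H.exists_lines hω (by norm_num)) fun ℓ hℓ =>
      H.isFreeCurve_arrA hω (by norm_num)
        (HesseConics.hasSaitoBasis_nineConics_zero_mul_lines hω) (ℓ := ℓ) hℓ
  constructor
  · rintro t (rfl | rfl | rfl | rfl | rfl | rfl | rfl)
    · exact triangle h2
    · exact triangle h2'.1
    · exact triangle h2'.2
    · exact triangle h0
    · exact square h1
    · exact square h1'.1
    · exact square h1'.2
  · rintro t (rfl | rfl | rfl)
    · exact h1.isFreeCurve_arrB hω
    · exact h1'.1.isFreeCurve_arrB hω
    · exact h1'.2.isFreeCurve_arrB hω
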